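/- Notation. Let $\mathbb R^3_1$ be $\mathbb R^3$ with $\langle x,y\rangle=-x_1y_1+x_2y_2+x_3y_3$ and the pseudo vector product $\wedge$ determined by $\langle x,y\wedge z\rangle=\det(x,y,z)$; let $H^2=\{x:\langle x,x\rangle=-1,\ x_1>0\}$ and $S^2_1=\{x:\langle x,x\rangle=1\}$. Let $I\subset\mathbb R$ be a non-degenerate interval. (At an end point of an interval that belongs to it, derivatives and germs are one-sided.) A *spacelike Legendre curve* on $I$ is a pair of smooth maps $\gamma:I\to H^2$, $\nu:I\to S_1^2$ with $\langle\gamma,\nu\rangle=0$ and $\langle\dot\gamma,\nu\rangle=0$. Put $\mu=\gamma\wedge\nu$; the *curvature* $(m,n)$ of $(\gamma,\nu)$ is given by $\dot\gamma=m\mu$, $\dot\nu=n\mu$, i.e. $m=\langle\dot\gamma,\mu\rangle$, $n=\langle\dot\nu,\mu\rangle$. If $f:I\to\mathbb R$ is a smooth function with $m+fn=0$ on $I$, the *horocyclic evolute* is $$Ev^\pm(\gamma)(t)=\gamma(t)+f(t)\nu(t)+\tfrac{f(t)^2}{2}\bigl(\gamma(t)\pm\mu(t)\bigr),\qquad t\in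 I.$$ A *horocyclic parallel* of $\gamma$ is a curve $$P^\pm(\gamma,\lambda)(t)=\gamma(t)+\lambda(t)\nu(t)+\tfrac{\lambda(t)^2}{2}\bigl(\gamma(t)\pm\mu(t)\bigr),\qquad t\in J,$$ where $J\subset I$ is a non-degenerate interval and $\lambda:J\to\mathbb R$ solves the Bernoulli equation $\dot\lambda=\mp\bigl(\tfrac{\lambda^2n}{2}+\lambda m\bigr)$ on $J$. Put $\nu_P^\pm=\lambda\gamma+\nu\pm\lambda\mu$ and let $m_P^\pm=\langle \dot P^\pm,\,P^\pm\wedge\nu_P^\pm\rangle$ be the first component of the curvature of $(P^\pm(\gamma,\lambda),\nu_P^\pm)$. A curve is singular at $t_0$ if its derivative vanishes there and regular otherwise. It has an *$(i,j)$-cusp* at $t_0$ if its germ at $t_0$ is $\mathcal A$-equivalent to the germ of $t\mapsto(t^i,t^j)$ at $0$, i.e. a smooth diffeomorphism germ of the line at $t_0$ and a smooth diffeomorphism germ from $H^2$ to $\mathbb R^2$ transform the one into the other (at an end point, into the corresponding half of the model). **Proposition 3.15.** Let $(\gamma,\nu)$ be a spacelike Legendre curve on $I$ with curvature $(m,n)$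 and let $f:I\to\mathbb R$ be a smooth function with $m+fn=0$ on $I$. For each choice of the sign $\pm$ (the same throughout) the following hold. 1. For every $t_0\in I$ there is a horocyclic parallel $P^\pm(\gamma,\lambda)$, defined on an interval $J\subset I$ that is a neighbourhood of $t_0$ in $I$, with $\lambda(t_0)=f(t_0)$, $Ev^\pm(\gamma)(t_0)=P^\pm(\gamma,\lambda)(t_0)$ and $m_P^\pm(t_0)=0$. Moreover, for every horocyclic parallel $P^\pm(\gamma,\lambda)$ on an interval $J\subset I$, the pair $(P^\pm(\gamma,\lambda),\nu^\pm_P)$ is a spacelike Legendre curve, and whenever $t_0\in J$ and $\lambda(t_0)=f(t_0)$, one has $Ev^\pm(\gamma)(t_0)=P^\pm(\gamma,\lambda)(t_0)$, $m_P^\pm(t_0)=0$, and $P^\pm(\gamma,\lambda)$ is singular at $t_0$. In particular, the image of $Ev^\pm(\gamma)$ is contained in the set of singular values of horocyclic parallels of $\gamma$ (each taken at a point $t_0$ of which the interval of definition is a neighbourhood in $I$). 2. Let $P^\pm(\gamma,\lambda)$ be a horocyclic parallel on $J\ni t_0$ with $Ev^\pm(\gamma)(t_0)=P^\pm(\gamma,\lambda)(t_0)$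 and $m_P^\pm(t_0)=0$, and suppose $n(t_0)\neq0$. Then $t_0$ is a regular point of $Ev^\pm(\gamma)$ if and only if $P^\pm(\gamma,\lambda)$ has a $(2,3)$-cusp at $t_0$. 3. Let $P^\pm(\gamma,\lambda)$ be a horocyclic parallel on $J\ni t_0$ with $Ev^\pm(\gamma)(t_0)=P^\pm(\gamma,\lambda)(t_0)$ and $m_P^\pm(t_0)=0$. Then $Ev^\pm(\gamma)$ has a $(2,3)$-cusp at $t_0$ if and only if $P^\pm(\gamma,\lambda)$ has a $(3,4)$-cusp at $t_0$. -/

import Mathlib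

open Set Filter Topology
open scoped ContDiff

noncomputable section

namespace Horocyclic

/-- The pseudo scalar product `-x₁y₁ + x₂y₂ + x₃y₃` of Lorentz-Minkowski 3-space. -/
def mink (x y : Fin 3 → ℝ) : ℝ := -(x 0 * y 0) + x 1 * y 1 + x 2 * y 2

/-- The pseudo vector product: the formal determinant with rows
`(-e₁, e₂, e₃)`, `x`, `y`. -/
def wedge (x y : Fin 3 → ℝ) : Fin 3 → ℝ :=
  ![-(x 1 * y 2 - x 2 * y 1), -(x 0 * y 2 - x 2 * y 0), x 0 * y 1 - x 1 * y 0]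

/-- Hyperbolic 2-space: the branch `x₁ > 0` of `⟨x, x⟩ = -1`. -/
def hyperbolicPlane : Set (Fin 3 → ℝ) := {x | mink x x = -1 ∧ 0 < x 0}

/-- De Sitter 2-space. -/
def deSitter : Set (Fin 3 → ℝ) := {x | mink x x = 1}

/-- `(γ, ν) : I → Δ₁` is a (smooth) spacelike Legendre curve on the interval `I`. At an end point
of `I` belonging to `I`, derivatives are one-sided. -/
structure IsSpacelikeLegendreCurve (I : Set ℝ) (γ ν : ℝ → Fin 3 → ℝ) : Prop where
  smooth_base : ContDiffOn ℝ ∞ γ I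
  smooth_normal : ContDiffOn ℝ ∞ ν I
  base_mem : ∀ t ∈ I, γ t ∈ hyperbolicPlane
  normal_mem : ∀ t ∈ I, ν t ∈ deSitter
  orthogonal : ∀ t ∈ I, mink (γ t) (ν t) = 0
  legendre : ∀ t ∈ I, mink (derivWithin γ I t) (ν t) = 0

/-- The third vector `μ = γ ∧ ν` of the moving frame `{γ, ν, μ}`. -/
def frameMu (γ ν : ℝ → Fin 3 → ℝ) (t : ℝ) : Fin 3 → ℝ := wedge (γ t) (ν t)

/-- First component `m` of the curvature of `(γ, ν)`. As `{γ, ν, μ}` is pseudo-orthonormal with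
`⟨μ, μ⟩ = 1`, this is the coefficient in the Frenet type formula `γ' = m μ`. -/
def curvM (I : Set ℝ) (γ ν : ℝ → Fin 3 → ℝ) (t : ℝ) : ℝ :=
  mink (derivWithin γ I t) (frameMu γ ν t)

/-- Second component `n` of the curvature of `(γ, ν)`: the coefficient in the Frenet type formula
`ν' = n μ`. -/
def curvN (I : Set ℝ) (γ ν : ℝ → Fin 3 → ℝ) (t : ℝ) : ℝ :=
  mink (derivWithin ν I t) (frameMu γ ν t)

/-- The point with parameter `s(t)` on the normal horocycle of `γ` at `t`,
`γ + s ν + (s² / 2) (γ ± μ)`; here `ε = 1` or `ε = -1` is the sign `±`. -/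
def normalHorocyclePoint (ε : ℝ) (γ ν : ℝ → Fin 3 → ℝ) (s : ℝ → ℝ) (t : ℝ) : Fin 3 → ℝ :=
  γ t + s t • ν t + (s t ^ 2 / 2) • (γ t + ε • frameMu γ ν t)

/-- The horocyclic evolute `Ev^±(γ)`, where `f` is a smooth function with `m + f n = 0`. -/
def evolute (ε : ℝ) (γ ν : ℝ → Fin 3 → ℝ) (f : ℝ → ℝ) : ℝ → Fin 3 → ℝ :=
  normalHorocyclePoint ε γ ν f

/-- `l` is a solution, on the non-degenerate subinterval `J` of `I`, of the Bernoulli equation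
`l' = ∓ (l² n / 2 + l m)`. Solutions need not exist on all of `I`. -/
structure IsBernoulliSolution (ε : ℝ) (I : Set ℝ) (γ ν : ℝ → Fin 3 → ℝ)
    (J : Set ℝ) (l : ℝ → ℝ) : Prop where
  subset : J ⊆ I
  ordConnected : J.OrdConnected
  nontrivial : J.Nontrivial
  ode : ∀ t ∈ J, HasDerivWithinAt l
    (-ε * (l t ^ 2 * curvN I γ ν t / 2 + l t * curvM I γ ν t)) J t

/-- The horocyclic parallel `P^±(γ, l)`, where `l` is a solution of the Bernoulli equation. -/
def parallelCurve (ε : ℝ) (γ ν : ℝ → Fin 3 → ℝ) (l : ℝ → ℝ) : ℝ → Fin 3 → ℝ :=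
  normalHorocyclePoint ε γ ν l

/-- The unit normal `l γ + ν ± l μ` of the horocyclic parallel. -/
def parallelNormal (ε : ℝ) (γ ν : ℝ → Fin 3 → ℝ) (l : ℝ → ℝ) (t : ℝ) : Fin 3 → ℝ :=
  l t • γ t + ν t + (ε * l t) • frameMu γ ν t

/-- First component `m_P^±` of the curvature of the horocyclic parallel with its normal, on the
interval `J` on which `l` solves the Bernoulli equation. -/
def parallelM (ε : ℝ) (γ ν : ℝ → Fin 3 → ℝ) (J : Set ℝ) (l : ℝ → ℝ) (t : ℝ) : ℝ :=
  curvM J (parallelCurve ε γ ν l) (parallelNormal ε γ ν l) t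

/-- `t₀` is a singular point of the curve `c` defined on the interval `I`; it is a regular point
if this fails. -/
def IsSingularPoint (I : Set ℝ) (c : ℝ → Fin 3 → ℝ) (t₀ : ℝ) : Prop :=
  derivWithin c I t₀ = 0

/-- The set of all singular values of horocyclic parallels of `γ`. -/
def parallelSingularValues (ε : ℝ) (I : Set ℝ) (γ ν : ℝ → Fin 3 → ℝ) : Set (Fin 3 → ℝ) :=
  {x | ∃ (J : Set ℝ) (l : ℝ → ℝ) (t : ℝ), IsBernoulliSolution ε I γ ν J l ∧ t ∈ J ∧
    J ∈ 𝓝[I] t ∧ IsSingularPoint J (parallelCurve ε γ ν l) t ∧ parallelCurve ε γ ν l t = x}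

/-- The global chart `(x₁, x₂, x₃) ↦ (x₂, x₃)` of the hyperbolic plane: it is a diffeomorphism onto
the plane, with inverse `(y, z) ↦ (√(1 + y² + z²), y, z)`. -/
def chart (x : Fin 3 → ℝ) : ℝ × ℝ := (x 1, x 2)

/-- A curve `c` in the hyperbolic plane, defined on the interval `I`, has an `(i, j)`-cusp at `t₀`:
it is `𝒜`-equivalent to the germ of `t ↦ (t ^ i, t ^ j)` at the origin, that is, there are
a diffeomorphism germ `φ : (ℝ, t₀) → (ℝ, 0)` of the source and a diffeomorphism germ
`Ψ ∘ chart : (H², c t₀) → (ℝ², 0)` of the target that transform one into the other. If `t₀` is an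
end point of `I`, the germ of `c` is one-sided and is compared with the corresponding half of the
model. -/
def HasCusp (i j : ℕ) (I : Set ℝ) (c : ℝ → Fin 3 → ℝ) (t₀ : ℝ) : Prop :=
  ∃ (φ : OpenPartialHomeomorph ℝ ℝ) (Ψ : OpenPartialHomeomorph (ℝ × ℝ) (ℝ × ℝ)),
    t₀ ∈ φ.source ∧ φ t₀ = 0 ∧
    ContDiffOn ℝ ∞ φ φ.source ∧ ContDiffOn ℝ ∞ φ.symm φ.target ∧
    chart (c t₀) ∈ Ψ.source ∧ Ψ (chart (c t₀)) = (0, 0) ∧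
    ContDiffOn ℝ ∞ Ψ Ψ.source ∧ ContDiffOn ℝ ∞ Ψ.symm Ψ.target ∧
    ∀ᶠ t in 𝓝[I] t₀, chart (c t) ∈ Ψ.source ∧ Ψ (chart (c t)) = (φ t ^ i, φ t ^ j)

end Horocyclic

end

/-!
A horocyclic parallel `P` with its normal `ν_P` is again a spacelike Legendre curve, with curvature
`(m + l n, n)`. As `m = -f n`, its first component is `n g` with `g = l - f`, so `P` is singular
where `l = f`, which is where it meets the evolute. The evolute, too, is a spacelike Legendre curve,
with a suitable normal. Its curvature is `(σ, n + ε σ)`, where `σ = f' - ε f² n / 2`. The Bernoulli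
equation for `l` becomes `g' = -σ - ε n g² / 2`. Where `g = 0`, the first derivative of `n g` is
therefore `-n σ`, and its second derivative is `-n σ'` if also `σ = 0`.

It remains to read off cusps from the curvature: a spacelike Legendre curve with curvature `(m, n)`
has a `(k + 1, k + 2)`-cusp (`k = 1, 2`) if and only if `m` vanishes to order `k` and `n ≠ 0`
(`IsSpacelikeLegendreCurve.hasCusp_succ_iff`). In the chart the curve has the velocity `m w`, and
the criterion is one for plane curves whose velocity is a function times a vector field `w`
(`hasPlanarCusp_succ_iff`). Necessity is a computation with first derivatives. For sufficiency the
curve is extended smoothly past `t₀` if `t₀` is an end point (Borel's lemma and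
`exists_contDiff_eventuallyEq_nhdsWithin`) and is written as `(sᵏ⁺¹ u(s), sᵏ⁺² v(s))` in linear
coordinates. A root as new parameter `τ` makes the first coordinate a multiple of `τᵏ⁺¹`, and the
second one is then a smooth function of `(τᵏ⁺¹, τᵏ⁺²)`, because every smooth function splits as
`A(τ²) + τ B(τ²)`, and as `A(τ³) + τ B(τ³) + τ² C(τ³)`
(`hasNormalForm_two_three`, `hasNormalForm_three_four`). For the `(3, 4)`-cusp the obstructing term
`τ⁵` is removed beforehand by adding a multiple of the second coordinate to the first.
-/

noncomputable section

namespace SmoothGerm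

/-! ### Borel's lemma and smooth extension past end points -/

/-- **Borel's lemma**: every sequence of reals is the sequence of derivatives at `0` of a smooth
function. -/
theorem exists_contDiff_iteratedDeriv_eq (a : ℕ → ℝ) :
    ∃ b : ℝ → ℝ, ContDiff ℝ ∞ b ∧ ∀ k, iteratedDeriv k b 0 = a k := by
  let χ : ContDiffBump (0 : ℝ) := ⟨1, 2, one_pos, one_lt_two⟩
  have hχ : ContDiff ℝ ∞ χ := χ.contDiff
  let h : ℕ → ℝ → ℝ := fun n x => χ x * x ^ n
  have hh : ∀ n, ContDiff ℝ ∞ (h n) := fun n => hχ.mul (contDiff_id.pow n)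
  have hsupp : ∀ n, HasCompactSupport (h n) := fun n => χ.hasCompactSupport.mul_right
  have hb : ∀ n k, ∃ C, ∀ x, ‖iteratedDeriv k (h n) x‖ ≤ C := by
    intro n k
    obtain ⟨C, hC⟩ := ((hsupp n).iteratedFDeriv (𝕜 := ℝ) k).exists_bound_of_continuous
      ((hh n).continuous_iteratedFDeriv (m := k) (by exact_mod_cast le_top))
    exact ⟨C, fun x => by rw [← norm_iteratedFDeriv_eq_norm_iteratedDeriv]; exact hC x⟩
  choose C hC using hb
  have hC0 : ∀ n k, 0 ≤ C n k := fun n k => (norm_nonneg _).trans (hC n k 0)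
  let c : ℕ → ℝ := fun n => a n / n.factorial
  -- The `n`-th monomial is cut off at scale `1 / L n`, with `L n` so large that its derivatives of
  -- order `< n` are bounded by `2⁻ⁿ`.
  let L : ℕ → ℝ := fun n => 1 + 2 ^ n * (|c n| * ∑ k ∈ Finset.range n, C n k)
  have hS0 : ∀ n, 0 ≤ ∑ k ∈ Finset.range n, C n k := fun n => Finset.sum_nonneg fun k _ => hC0 n k
  have hL1 : ∀ n, 1 ≤ L n := fun n => by
    have : 0 ≤ (2 : ℝ) ^ n * (|c n| * ∑ k ∈ Finset.range n, C n k) := by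
      have := hS0 n
      positivity
    simp only [L]; linarith
  have hL0 : ∀ n, 0 < L n := fun n => zero_lt_one.trans_le (hL1 n)
  let g : ℕ → ℝ → ℝ := fun n x => c n * (L n ^ n)⁻¹ * h n (L n * x)
  have hg : ∀ n, ContDiff ℝ ∞ (g n) := fun n =>
    contDiff_const.mul ((hh n).comp (contDiff_const.mul contDiff_id))
  have hgd : ∀ n k x, iteratedDeriv k (g n) x =
      c n * (L n ^ n)⁻¹ * (L n ^ k * iteratedDeriv k (h n) (L n * x)) := by
    intro n k x
    have h1 := iteratedDeriv_comp_const_mul (n := k) ((hh n).of_le (by exact_mod_cast le_top)) (L n)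
    have h2 : iteratedDeriv k (g n) x =
        c n * (L n ^ n)⁻¹ * iteratedDeriv k (fun x => h n (L n * x)) x :=
      iteratedDeriv_const_mul_field _ _
    rw [h2, h1]
  let v : ℕ → ℕ → ℝ := fun k n =>
    (if n ∈ Finset.range (k + 1) then |c n * (L n ^ n)⁻¹| * (L n ^ k * C n k) else 0) + (1 / 2) ^ n
  have hv : ∀ k : ℕ, Summable (v k) := fun k =>
    (summable_of_ne_finset_zero (s := Finset.range (k + 1)) fun n hn => if_neg hn).add
      (summable_geometric_of_lt_one (by norm_num) (by norm_num))
  have hbound : ∀ k n x, ‖iteratedFDeriv ℝ k (g n) x‖ ≤ v k n := by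
    intro k n x
    rw [norm_iteratedFDeriv_eq_norm_iteratedDeriv, hgd, norm_mul, norm_mul (L n ^ k),
      Real.norm_eq_abs, Real.norm_eq_abs (L n ^ k), abs_of_nonneg (pow_nonneg (hL0 n).le k)]
    simp only [v]
    split_ifs with hn
    · have : |c n * (L n ^ n)⁻¹| * (L n ^ k * ‖iteratedDeriv k (h n) (L n * x)‖) ≤
          |c n * (L n ^ n)⁻¹| * (L n ^ k * C n k) := by
        have := hC n k (L n * x)
        have := (hL0 n).le
        gcongr
      have : (0 : ℝ) ≤ (1 / 2) ^ n := by positivity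
      linarith
    · have hkn : k < n := by simpa using hn
      have hCk : C n k ≤ ∑ k ∈ Finset.range n, C n k :=
        Finset.single_le_sum (f := fun k => C n k) (fun k _ => hC0 n k) (Finset.mem_range.2 hkn)
      have hLk : (L n ^ n)⁻¹ * L n ^ k ≤ (L n)⁻¹ := by
        rw [inv_mul_le_iff₀ (pow_pos (hL0 n) n)]
        have : L n ^ k ≤ L n ^ (n - 1) := pow_le_pow_right₀ (hL1 n) (by omega)
        refine this.trans (le_of_eq ?_)
        have h3 : L n ^ n = L n ^ (n - 1) * L n := by rw [← pow_succ]; congr 1; omega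
        rw [h3, mul_assoc, mul_inv_cancel₀ (hL0 n).ne', mul_one]
      have hlast : |c n| * (∑ k ∈ Finset.range n, C n k) ≤ (1 / 2) ^ n * L n := by
        simp only [L, mul_add, ← mul_assoc, ← mul_pow]
        norm_num
      have h0 := abs_nonneg (c n)
      have h1 := norm_nonneg (iteratedDeriv k (h n) (L n * x))
      calc |c n * (L n ^ n)⁻¹| * (L n ^ k * ‖iteratedDeriv k (h n) (L n * x)‖)
          = |c n| * ‖iteratedDeriv k (h n) (L n * x)‖ * ((L n ^ n)⁻¹ * L n ^ k) := by
            rw [abs_mul, abs_of_pos (inv_pos.2 (pow_pos (hL0 n) n))]; ring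
        _ ≤ |c n| * (∑ k ∈ Finset.range n, C n k) * (L n)⁻¹ := by
            refine mul_le_mul (mul_le_mul_of_nonneg_left ((hC n k _).trans hCk) h0) hLk
              (mul_nonneg (inv_nonneg.2 (pow_nonneg (hL0 n).le _)) (pow_nonneg (hL0 n).le _))
              (mul_nonneg h0 (hS0 n))
        _ ≤ 0 + (1 / 2) ^ n := by
            rw [zero_add, mul_inv_le_iff₀ (hL0 n)]; exact hlast
  refine ⟨fun x => ∑' n, g n x, contDiff_tsum hg (fun k _ => hv k) fun k n x _ => hbound k n x, ?_⟩
  intro k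
  have hsum : Summable fun n => iteratedFDeriv ℝ k (g n) 0 :=
    .of_norm_bounded (hv k) fun n => hbound k n 0
  rw [iteratedDeriv_eq_iteratedFDeriv, iteratedFDeriv_tsum_apply (N := ⊤) hg (fun k _ => hv k)
    (fun k n x _ => hbound k n x) le_top, ContinuousMultilinearMap.tsum_eval hsum]
  simp_rw [← iteratedDeriv_eq_iteratedFDeriv]
  have hterm : ∀ n, iteratedDeriv k (g n) 0 = if n = k then a k else 0 := by
    intro n
    have hloc : g n =ᶠ[𝓝 0] fun x => c n * x ^ n := by
      have hnear : ∀ᶠ x in 𝓝 (0 : ℝ), L n * x ∈ Metric.closedBall (0 : ℝ) 1 := by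
        have : Tendsto (fun x => L n * x) (𝓝 0) (𝓝 0) := by
          simpa using (continuous_const_mul (L n)).tendsto (0 : ℝ)
        exact this.eventually (Metric.closedBall_mem_nhds _ one_pos)
      filter_upwards [hnear] with x hx
      have : χ (L n * x) = 1 := χ.one_of_mem_closedBall hx
      simp only [g, h, this, mul_pow, one_mul]
      have := (pow_pos (hL0 n) n).ne'
      field_simp
    rw [hloc.iteratedDeriv_eq, iteratedDeriv_const_mul_field, iteratedDeriv_fun_pow_zero]
    simp only [c]
    split_ifs with h1 h2 h2
    · subst h1; field_simp
    · omega
    · omega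
    · simp
  simp_rw [hterm]
  exact tsum_ite_eq k _

/-- A function with a chain of derivatives of all orders is smooth. -/
theorem contDiffOn_of_hasDerivAt {D : ℕ → ℝ → ℝ} {U : Set ℝ} (hU : IsOpen U)
    (h : ∀ k, ∀ x ∈ U, HasDerivAt (D k) (D (k + 1) x) x) : ContDiffOn ℝ ∞ (D 0) U := by
  suffices H : ∀ n : ℕ, ∀ k, ContDiffOn ℝ n (D k) U from contDiffOn_infty.2 fun n => H n 0
  intro n
  induction n with
  | zero => exact fun k => contDiffOn_zero.2 fun x hx => (h k x hx).continuousAt.continuousWithinAt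
  | succ n ih =>
    intro k
    have := (contDiffOn_succ_iff_deriv_of_isOpen (𝕜 := ℝ) (n := n) (f := D k) hU).2
      ⟨fun x hx => (h k x hx).differentiableAt.differentiableWithinAt, by simp,
        (ih (k + 1)).congr fun x hx => (h k x hx).deriv⟩
    exact_mod_cast this

/-- A germ of a smooth map is the germ of a globally smooth map, by multiplication with a bump
function. -/
theorem exists_contDiff_eventuallyEq {E F : Type*} [NormedAddCommGroup E] [NormedSpace ℝ E]
    [HasContDiffBump E] [NormedAddCommGroup F] [NormedSpace ℝ F] {f : E → F} {U : Set E} {a : E}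
    (hU : U ∈ 𝓝 a) (hf : ContDiffOn ℝ ∞ f U) :
    ∃ g : E → F, ContDiff ℝ ∞ g ∧ g =ᶠ[𝓝 a] f := by
  obtain ⟨δ, hδ, hball⟩ := Metric.mem_nhds_iff.1 hU
  let χ : ContDiffBump a := ⟨δ / 4, δ / 2, by positivity, by linarith⟩
  refine ⟨fun x => χ x • f x, contDiff_iff_contDiffAt.2 fun x => ?_, ?_⟩
  · by_cases hx : x ∈ Metric.ball a δ
    · exact χ.contDiff.contDiffAt.smul ((hf.mono hball).contDiffAt (Metric.isOpen_ball.mem_nhds hx))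
    · have hx' : x ∈ (Metric.closedBall a (δ / 2))ᶜ := fun h =>
        hx (Metric.closedBall_subset_ball (by linarith) h)
      have : (fun x => χ x • f x) =ᶠ[𝓝 x] fun _ => 0 := by
        filter_upwards [Metric.isClosed_closedBall.isOpen_compl.mem_nhds hx'] with y hy
        rw [χ.zero_of_le_dist, zero_smul]
        have : ¬ dist y a ≤ δ / 2 := hy
        exact (not_le.1 this).le
      exact contDiffAt_const.congr_of_eventuallyEq this
  · filter_upwards [Metric.closedBall_mem_nhds a (show 0 < δ / 4 by positivity)] with x hx
    rw [χ.one_of_mem_closedBall hx, one_smul]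

theorem eventually_mem_nhds_or_compl_mem_nhds {J : Set ℝ} (hJ : J.OrdConnected) {a : ℝ}
    (ha : a ∈ J) : ∀ᶠ t in 𝓝[≠] a, J ∈ 𝓝 t ∨ Jᶜ ∈ 𝓝 t := by
  rw [← Iio_union_Ioi, nhdsWithin_union, eventually_sup]
  constructor
  · by_cases h : ∃ b ∈ J, b < a
    · obtain ⟨b, hb, hba⟩ := h
      filter_upwards [Ioo_mem_nhdsLT hba] with t ht
      exact Or.inl (mem_of_superset (Ioo_mem_nhds ht.1 ht.2)
        (Ioo_subset_Icc_self.trans (hJ.out hb ha)))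
    · push Not at h
      filter_upwards [self_mem_nhdsWithin] with t ht
      exact Or.inr (mem_of_superset (Iio_mem_nhds ht) fun s hs hsJ => (h s hsJ).not_gt hs)
  · by_cases h : ∃ b ∈ J, a < b
    · obtain ⟨b, hb, hba⟩ := h
      filter_upwards [Ioo_mem_nhdsGT hba] with t ht
      exact Or.inl (mem_of_superset (Ioo_mem_nhds ht.1 ht.2)
        (Ioo_subset_Icc_self.trans (hJ.out ha hb)))
    · push Not at h
      filter_upwards [self_mem_nhdsWithin] with t ht
      exact Or.inr (mem_of_superset (Ioi_mem_nhds ht) fun s hs hsJ => (h s hsJ).not_gt hs)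

theorem uniqueDiffOn_of_ordConnected {J : Set ℝ} (hJ : J.OrdConnected) (hJ' : J.Nontrivial) :
    UniqueDiffOn ℝ J :=
  uniqueDiffOn_convex hJ.convex (hJ.convex.nontrivial_iff_nonempty_interior.1 hJ')

/-- A smooth function on a non-degenerate interval extends smoothly past a point `a` of it, also if
`a` is an end point: outside the interval it is continued by a function with the same derivatives
at `a`, which Borel's lemma provides. -/
theorem exists_contDiff_eventuallyEq_nhdsWithin {J : Set ℝ} (hJ : J.OrdConnected)
    (hJ' : J.Nontrivial) {f : ℝ → ℝ} (hf : ContDiffOn ℝ ∞ f J) {a : ℝ} (ha : a ∈ J) :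
    ∃ F : ℝ → ℝ, ContDiff ℝ ∞ F ∧ F =ᶠ[𝓝[J] a] f := by
  classical
  have hu := uniqueDiffOn_of_ordConnected hJ hJ'
  obtain ⟨b, hb, hbd⟩ := exists_contDiff_iteratedDeriv_eq fun k => iteratedDerivWithin k f J a
  let B : ℝ → ℝ := fun t => b (t - a)
  have hB : ContDiff ℝ ∞ B := hb.comp (contDiff_id.sub contDiff_const)
  have hBa : ∀ k, iteratedDeriv k B a = iteratedDerivWithin k f J a := by
    intro k
    have : iteratedDeriv k B = fun t => iteratedDeriv k b (t - a) :=
      iteratedDeriv_comp_sub_const k b a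
    rw [this]
    simp [hbd]
  let D : ℕ → ℝ → ℝ := fun k => J.piecewise (iteratedDerivWithin k f J) (iteratedDeriv k B)
  have hfD : ∀ k, ∀ t ∈ J, HasDerivWithinAt (iteratedDerivWithin k f J)
      (iteratedDerivWithin (k + 1) f J t) J t := by
    intro k t ht
    rw [iteratedDerivWithin_succ]
    exact ((hf.differentiableOn_iteratedDerivWithin (m := k)
      (by exact_mod_cast ENat.natCast_lt_top k) hu) t ht).hasDerivWithinAt
  have hBD : ∀ k t, HasDerivAt (iteratedDeriv k B) (iteratedDeriv (k + 1) B t) t := by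
    intro k t
    rw [iteratedDeriv_succ]
    exact ((hB.differentiable_iteratedDeriv k
      (by exact_mod_cast ENat.natCast_lt_top k)) t).hasDerivAt
  have hDa : ∀ k, HasDerivAt (D k) (D (k + 1) a) a := by
    intro k
    have h1 : HasDerivWithinAt (D k) (D (k + 1) a) J a := by
      have hval : D (k + 1) a = iteratedDerivWithin (k + 1) f J a := piecewise_eq_of_mem _ _ _ ha
      rw [hval]
      exact (hfD k a ha).congr (fun t ht => piecewise_eq_of_mem _ _ _ ht)
        (piecewise_eq_of_mem _ _ _ ha)
    have h2 : HasDerivWithinAt (D k) (D (k + 1) a) Jᶜ a := by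
      have hval : D (k + 1) a = iteratedDeriv (k + 1) B a := by
        rw [hBa]; exact piecewise_eq_of_mem _ _ _ ha
      rw [hval]
      refine (hBD k a).hasDerivWithinAt.congr (fun t ht => piecewise_eq_of_notMem _ _ _ ht) ?_
      rw [hBa]
      exact piecewise_eq_of_mem _ _ _ ha
    simpa using h1.union h2
  obtain ⟨U, hUa, hU, hUa'⟩ : ∃ U : Set ℝ,
      (∀ t ∈ U, t ≠ a → J ∈ 𝓝 t ∨ Jᶜ ∈ 𝓝 t) ∧ IsOpen U ∧ a ∈ U := by
    have := eventually_nhdsWithin_iff.1 (eventually_mem_nhds_or_compl_mem_nhds hJ ha)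
    obtain ⟨U, h1, h2, h3⟩ := eventually_nhds_iff.1 this
    exact ⟨U, fun t ht => h1 t ht, h2, h3⟩
  have hD : ∀ k, ∀ t ∈ U, HasDerivAt (D k) (D (k + 1) t) t := by
    intro k t ht
    by_cases hta : t = a
    · rw [hta]; exact hDa k
    rcases hUa t ht hta with h | h
    · have hval : D (k + 1) t = iteratedDerivWithin (k + 1) f J t :=
        piecewise_eq_of_mem _ _ _ (mem_of_mem_nhds h)
      rw [hval]
      refine ((hfD k t (mem_of_mem_nhds h)).hasDerivAt h).congr_of_eventuallyEq ?_
      filter_upwards [h] with s hs using piecewise_eq_of_mem _ _ _ hs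
    · have hval : D (k + 1) t = iteratedDeriv (k + 1) B t :=
        piecewise_eq_of_notMem _ _ _ (mem_of_mem_nhds h)
      rw [hval]
      refine (hBD k t).congr_of_eventuallyEq ?_
      filter_upwards [h] with s hs using piecewise_eq_of_notMem _ _ _ hs
  obtain ⟨F, hF, hFD⟩ := exists_contDiff_eventuallyEq (hU.mem_nhds hUa')
    (contDiffOn_of_hasDerivAt hU hD)
  refine ⟨F, hF, ?_⟩
  filter_upwards [hFD.filter_mono nhdsWithin_le_nhds, self_mem_nhdsWithin] with t ht htJ
  rw [ht]
  exact (piecewise_eq_of_mem _ _ _ htJ).trans (by simp)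

/-! ### Hadamard's lemma -/

theorem hasDerivAt_integral_pow_mul_comp {h : ℝ → ℝ} (hh : ContDiff ℝ 1 h) (k : ℕ) (x : ℝ) :
    HasDerivAt (fun x => ∫ s in (0 : ℝ)..1, s ^ k * h (s * x))
      (∫ s in (0 : ℝ)..1, s ^ (k + 1) * deriv h (s * x)) x := by
  have hd : Continuous (deriv h) := hh.continuous_deriv le_rfl
  obtain ⟨C, hC⟩ := (isCompact_closedBall (0 : ℝ) (|x| + 1)).exists_bound_of_continuousOn
    hd.continuousOn
  refine (intervalIntegral.hasDerivAt_integral_of_dominated_loc_of_deriv_le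
    (F := fun x s => s ^ k * h (s * x)) (F' := fun x s => s ^ (k + 1) * deriv h (s * x))
    (bound := fun _ => C) (Metric.ball_mem_nhds x one_pos) ?_ ?_ ?_ ?_ ?_ ?_).2
  · refine Eventually.of_forall fun y => Continuous.aestronglyMeasurable ?_
    exact (continuous_pow k).mul (hh.continuous.comp (continuous_mul_const y))
  · exact ((continuous_pow k).mul
      (hh.continuous.comp (continuous_mul_const x))).intervalIntegrable _ _
  · exact ((continuous_pow (k + 1)).mul
      (hd.comp (continuous_mul_const x))).aestronglyMeasurable
  · refine Eventually.of_forall fun s hs y hy => ?_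
    rw [uIoc_of_le zero_le_one] at hs
    have hs0 := hs.1.le
    have hs1 := hs.2
    have hy' : |y| ≤ |x| + 1 := by
      have h1 : |y - x| < 1 := by simpa [Real.dist_eq] using hy
      have h2 := abs_sub_abs_le_abs_sub y x
      linarith
    have h1 : ‖deriv h (s * y)‖ ≤ C := by
      refine hC _ ?_
      rw [mem_closedBall_zero_iff, Real.norm_eq_abs, abs_mul, abs_of_nonneg hs0]
      have := abs_nonneg y
      nlinarith
    have h2 : ‖s ^ (k + 1)‖ ≤ 1 := by
      rw [norm_pow, Real.norm_eq_abs, abs_of_nonneg hs0]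
      exact pow_le_one₀ hs0 hs1
    rw [norm_mul]
    have := norm_nonneg (deriv h (s * y))
    have := norm_nonneg (s ^ (k + 1))
    nlinarith
  · exact intervalIntegrable_const
  · refine Eventually.of_forall fun s _ y _ => ?_
    have h1 : HasDerivAt (fun y => s * y) s y := by simpa using (hasDerivAt_id y).const_mul s
    have h2 : HasDerivAt h (deriv h (s * y)) (s * y) :=
      (hh.differentiable one_ne_zero _).hasDerivAt
    have := ((h2.comp y h1).const_mul (s ^ k))
    convert! this using 1
    ring

/-- Dividing out the power of `s` in a primitive: `∫₀ˢ rᵏ u(r) dr = sᵏ⁺¹ v(s)` with the smooth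
function `v(s) = ∫₀¹ rᵏ u(r s) dr`. -/
theorem exists_contDiff_hasDerivAt_pow_mul {u : ℝ → ℝ} (hu : ContDiff ℝ ∞ u) (k : ℕ) :
    ∃ v : ℝ → ℝ, ContDiff ℝ ∞ v ∧ v 0 = u 0 / (k + 1) ∧
      ∀ s, HasDerivAt (fun s => s ^ (k + 1) * v s) (s ^ k * u s) s := by
  let D : ℕ → ℝ → ℝ := fun j t => ∫ r in (0 : ℝ)..1, r ^ (k + j) * iteratedDeriv j u (r * t)
  have hD : ∀ j, ∀ x ∈ (univ : Set ℝ), HasDerivAt (D j) (D (j + 1) x) x := by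
    intro j x _
    have h1 : ContDiff ℝ 1 (iteratedDeriv j u) := by
      rw [iteratedDeriv_eq_iterate]
      exact ContDiff.iterate_deriv' 1 j (hu.of_le (by exact_mod_cast le_top))
    have := hasDerivAt_integral_pow_mul_comp h1 (k + j) x
    rwa [← iteratedDeriv_succ] at this
  refine ⟨D 0, contDiffOn_univ.1 (contDiffOn_of_hasDerivAt isOpen_univ hD), ?_, fun t => ?_⟩
  · simp [D, intervalIntegral.integral_mul_const]
    field_simp
  · have hc : Continuous fun r => r ^ k * u r := (continuous_pow k).mul hu.continuous
    have hEq : (fun s => s ^ (k + 1) * D 0 s) = fun s => ∫ r in (0 : ℝ)..s, r ^ k * u r := by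
      funext s
      have h := intervalIntegral.smul_integral_comp_mul_right (a := 0) (b := 1)
        (fun r => r ^ k * u r) s
      rw [zero_mul, one_mul] at h
      rw [← h]
      simp only [D, add_zero, iteratedDeriv_zero, smul_eq_mul, mul_pow]
      rw [← intervalIntegral.integral_const_mul, ← intervalIntegral.integral_const_mul]
      congr 1
      funext r
      ring
    rw [hEq]
    exact intervalIntegral.integral_hasDerivAt_right (hc.intervalIntegrable _ _)
      (hc.stronglyMeasurableAtFilter _ _) hc.continuousAt

/-- **Hadamard's lemma**. -/
theorem exists_contDiff_eq_mul {f : ℝ → ℝ} (hf : ContDiff ℝ ∞ f) (h0 : f 0 = 0) :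
    ∃ g : ℝ → ℝ, ContDiff ℝ ∞ g ∧ g 0 = deriv f 0 ∧ ∀ t, f t = t * g t := by
  obtain ⟨g, hg, hg0, hfg⟩ := exists_contDiff_hasDerivAt_pow_mul
    (contDiff_infty_iff_deriv.1 hf).2 0
  refine ⟨g, hg, by simpa using hg0, fun t => ?_⟩
  have hd : ∀ t, HasDerivAt (fun t => f t - t ^ (0 + 1) * g t) 0 t := fun t => by
    simpa using (hf.differentiable (by simp) t).hasDerivAt.fun_sub (hfg t)
  have := is_const_of_deriv_eq_zero (fun t => (hd t).differentiableAt) (fun t => (hd t).deriv) t 0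
  simp only [h0, zero_add, pow_one, zero_mul, sub_zero] at this
  linarith

/-! ### Flat functions and Taylor expansions -/

/-- A smooth function that vanishes to infinite order at `0`; in terms of growth this is
`Q t = O(tᴺ)` for all `N`. -/
structure IsFlat (Q : ℝ → ℝ) : Prop where
  contDiff : ContDiff ℝ ∞ Q
  isBigO : ∀ N : ℕ, Q =O[𝓝 0] fun t => t ^ N

namespace IsFlat

variable {Q R : ℝ → ℝ}

theorem zero (hQ : IsFlat Q) : Q 0 = 0 := by
  have h := (hQ.isBigO 1).eq_zero_imp.self_of_nhds
  simpa using h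

theorem add (hQ : IsFlat Q) (hR : IsFlat R) : IsFlat fun t => Q t + R t :=
  ⟨hQ.contDiff.add hR.contDiff, fun N => (hQ.isBigO N).add (hR.isBigO N)⟩

theorem smul (c : ℝ) (hQ : IsFlat Q) : IsFlat fun t => c * Q t :=
  ⟨contDiff_const.mul hQ.contDiff, fun N => (hQ.isBigO N).const_mul_left c⟩

theorem id_mul (hQ : IsFlat Q) : IsFlat fun t => t * Q t := by
  refine ⟨contDiff_id.mul hQ.contDiff, fun N => ?_⟩
  have h1 : (fun t : ℝ => t) =O[𝓝 0] fun _ => (1 : ℝ) :=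
    (continuous_id.tendsto (0 : ℝ)).isBigO_one ℝ
  simpa using h1.mul (hQ.isBigO N)

theorem comp_neg (hQ : IsFlat Q) : IsFlat fun t => Q (-t) := by
  refine ⟨hQ.contDiff.comp contDiff_neg, fun N => ?_⟩
  have h0 : Tendsto (fun t : ℝ => -t) (𝓝 0) (𝓝 0) := by simpa using (continuous_neg.tendsto (0 : ℝ))
  refine ((hQ.isBigO N).comp_tendsto h0).trans (Asymptotics.IsBigO.of_bound 1 ?_)
  exact Eventually.of_forall fun t => by simp

theorem exists_eq_mul (hQ : IsFlat Q) : ∃ g, IsFlat g ∧ ∀ t, Q t = t * g t := by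
  obtain ⟨g, hg, -, hQg⟩ := exists_contDiff_eq_mul hQ.contDiff hQ.zero
  have h1 : ∀ N : ℕ, g =O[𝓝[≠] 0] fun t => t ^ N := by
    intro N
    obtain ⟨C, hC⟩ := (hQ.isBigO (N + 1)).bound
    refine Asymptotics.IsBigO.of_bound C ?_
    filter_upwards [hC.filter_mono nhdsWithin_le_nhds, self_mem_nhdsWithin] with t ht ht0
    have ht0' : 0 < |t| := abs_pos.2 ht0
    rw [hQg, norm_mul, pow_succ, norm_mul, Real.norm_eq_abs t, ← mul_assoc, mul_comm |t|] at ht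
    exact le_of_mul_le_mul_right ht ht0'
  have h0 : g 0 = 0 := by
    have hlim : Tendsto g (𝓝[≠] 0) (𝓝 0) := by
      refine (h1 1).trans_tendsto ?_
      have : Tendsto (fun t : ℝ => t ^ 1) (𝓝 0) (𝓝 0) := by
        simpa using (continuous_pow 1).tendsto (0 : ℝ)
      exact this.mono_left nhdsWithin_le_nhds
    exact tendsto_nhds_unique (hg.continuous.continuousWithinAt.tendsto) hlim
  refine ⟨g, ⟨hg, fun N => ?_⟩, hQg⟩
  obtain ⟨C, hC⟩ := (h1 N).bound
  refine Asymptotics.IsBigO.of_bound |C| ?_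
  filter_upwards [eventually_nhdsWithin_iff.1 hC] with t ht
  by_cases ht0 : t = 0
  · rw [ht0, h0]; simp only [norm_zero]; positivity
  · refine (ht ht0).trans ?_
    gcongr
    exact le_abs_self C

theorem deriv (hQ : IsFlat Q) : IsFlat (deriv Q) := by
  refine ⟨(contDiff_infty_iff_deriv.1 hQ.contDiff).2, fun N => ?_⟩
  induction N generalizing Q with
  | zero =>
    simpa using ((hQ.contDiff.continuous_deriv (by simp)).tendsto 0).isBigO_one ℝ
  | succ N ih =>
    obtain ⟨g, hg, hQg⟩ := hQ.exists_eq_mul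
    have : _root_.deriv Q = fun t => g t + t * _root_.deriv g t := by
      funext t
      have hgd : HasDerivAt g (_root_.deriv g t) t :=
        (hg.contDiff.differentiable (by simp) t).hasDerivAt
      have := ((hasDerivAt_id' t).fun_mul hgd).deriv
      rw [show Q = fun t => t * g t from funext hQg]
      simpa using this
    rw [this]
    refine (hg.isBigO (N + 1)).add ?_
    simp_rw [pow_succ' _ N]
    exact (Asymptotics.isBigO_refl _ _).mul (ih hg)

/-- A flat function stays smooth after composition with a `p`-th root `r` and division by a power of
the variable. The functions `x⁻ᵃ Q(r x)` with `Q` flat form a class that is closed under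
differentiation, because `r' = r / (p x)`. At `x = 0` the junk value of `x⁻ᵃ` does no harm, as
`Q (r 0) = 0`. -/
theorem contDiff_inv_pow_mul_comp {r : ℝ → ℝ} {p : ℕ}
    (hr : ∀ x, x ≠ 0 → HasDerivAt r (r x / (p * x)) x) (hrp : ∀ x, |r x| ^ p = |x|) (hp : p ≠ 0)
    (a : ℕ) (hQ : IsFlat Q) : ContDiff ℝ ∞ fun x => (x ^ a)⁻¹ * Q (r x) := by
  have hr0 : Tendsto r (𝓝 0) (𝓝 0) := by
    rw [tendsto_zero_iff_abs_tendsto_zero]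
    have h1 : Tendsto (fun x : ℝ => |x| ^ (1 / p : ℝ)) (𝓝 0) (𝓝 0) := by
      have : ContinuousAt (fun x : ℝ => |x| ^ (1 / p : ℝ)) 0 :=
        continuous_abs.continuousAt.rpow_const (Or.inr (by positivity))
      have h2 := this.tendsto
      rwa [abs_zero, Real.zero_rpow (by positivity)] at h2
    refine h1.congr fun x => ?_
    simp only [Function.comp]
    rw [← hrp x, one_div, Real.pow_rpow_inv_natCast (abs_nonneg _) hp]
  have hr00 : r 0 = 0 := by
    have := hrp 0
    rw [abs_zero, pow_eq_zero_iff hp] at this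
    exact abs_eq_zero.1 this
  -- `(x⁻ᵃ Q(r x))' = x⁻⁽ᵃ⁺¹⁾ (S a Q)(r x)`
  let S : ℕ → (ℝ → ℝ) → ℝ → ℝ := fun a Q t => -(a : ℝ) * Q t + (1 / p : ℝ) * (t * _root_.deriv Q t)
  have hS : ∀ a Q, IsFlat Q → IsFlat (S a Q) := fun a Q hQ =>
    (hQ.smul _).add (hQ.deriv.id_mul.smul _)
  have hstep : ∀ (a : ℕ) (Q : ℝ → ℝ), IsFlat Q → ∀ x,
      HasDerivAt (fun x => (x ^ a)⁻¹ * Q (r x)) ((x ^ (a + 1))⁻¹ * S a Q (r x)) x := by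
    intro a Q hQ x
    by_cases hx : x = 0
    · subst hx
      have hO : (fun x => (x ^ a)⁻¹ * Q (r x)) =O[𝓝 0] fun x => ‖x - 0‖ ^ 2 := by
        obtain ⟨C, hC⟩ := ((hQ.isBigO (p * (a + 2))).comp_tendsto hr0).bound
        refine Asymptotics.IsBigO.of_bound |C| ?_
        filter_upwards [hC] with x hx
        by_cases hx0 : x = 0
        · subst hx0
          rw [hr00, hQ.zero, mul_zero, norm_zero]
          positivity
        simp only [Function.comp, norm_pow, pow_mul, Real.norm_eq_abs, hrp] at hx
        have hxa : 0 < |x| := abs_pos.2 hx0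
        rw [Real.norm_eq_abs, abs_mul, abs_inv, abs_pow, sub_zero, Real.norm_eq_abs (‖x‖ ^ 2),
          abs_pow, Real.norm_eq_abs, abs_abs, inv_mul_le_iff₀ (by positivity)]
        calc |Q (r x)| ≤ C * |x| ^ (a + 2) := hx
          _ ≤ |C| * |x| ^ (a + 2) := by gcongr; exact le_abs_self C
          _ = |x| ^ a * (|C| * |x| ^ 2) := by ring
      have h1 := hO.hasFDerivAt (𝕜 := ℝ) one_lt_two
      have h2 := h1.hasDerivAt
      simpa using h2
    · have h1 : HasDerivAt (fun x : ℝ => (x ^ a)⁻¹) (-(a * x ^ (a - 1)) / (x ^ a) ^ 2) x :=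
        (hasDerivAt_pow a x).fun_inv (pow_ne_zero a hx)
      have h2 : HasDerivAt Q (_root_.deriv Q (r x)) (r x) :=
        (hQ.contDiff.differentiable (by simp) _).hasDerivAt
      have h3 := h1.mul (h2.comp x (hr x hx))
      convert! h3 using 1
      have hp' : (p : ℝ) ≠ 0 := by exact_mod_cast hp
      simp only [S, Function.comp]
      rcases a with _ | a
      · simp; field_simp
      · simp only [Nat.add_sub_cancel]
        push_cast
        field_simp
        ring
  let T : ℕ → ℝ → ℝ := fun k => Nat.rec Q (fun k q => S (a + k) q) k
  have hT : ∀ k, IsFlat (T k) := by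
    intro k
    induction k with
    | zero => exact hQ
    | succ k ih => exact hS _ _ ih
  have := contDiffOn_of_hasDerivAt (D := fun k x => (x ^ (a + k))⁻¹ * T k (r x)) isOpen_univ
    fun k x _ => hstep (a + k) (T k) (hT k) x
  exact contDiffOn_univ.1 this

end IsFlat

/-- `f t ~ ∑ aₖ tᵏ` as an asymptotic expansion at `0`. -/
def HasExpansion (f : ℝ → ℝ) (a : ℕ → ℝ) : Prop :=
  ∀ N : ℕ, (fun t => f t - ∑ k ∈ Finset.range N, a k * t ^ k) =O[𝓝 0] fun t => t ^ N

theorem hasExpansion_of_contDiff {f : ℝ → ℝ} (hf : ContDiff ℝ ∞ f) :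
    HasExpansion f fun k => iteratedDeriv k f 0 / k.factorial := by
  intro N
  have h1 := (taylor_isLittleO_univ (x₀ := 0) (n := N)
    (hf.of_le (by exact_mod_cast le_top))).isBigO
  simp only [taylor_within_apply, sub_zero, iteratedDerivWithin_univ, smul_eq_mul,
    Finset.sum_range_succ] at h1
  have h2 : (fun t : ℝ => iteratedDeriv N f 0 / N.factorial * t ^ N) =O[𝓝 0] fun t => t ^ N :=
    (Asymptotics.isBigO_refl _ _).const_mul_left _
  refine (h1.add h2).congr_left fun t => ?_
  have : ∀ k : ℕ, iteratedDeriv k f 0 / k.factorial * t ^ k =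
      (k.factorial : ℝ)⁻¹ * t ^ k * iteratedDeriv k f 0 := fun k => by rw [div_eq_mul_inv]; ring
  simp only [this]
  ring

/-- Borel's lemma in terms of asymptotic expansions. -/
theorem exists_contDiff_hasExpansion (a : ℕ → ℝ) :
    ∃ b : ℝ → ℝ, ContDiff ℝ ∞ b ∧ HasExpansion b a := by
  obtain ⟨b, hb, hba⟩ := exists_contDiff_iteratedDeriv_eq fun k => a k * k.factorial
  refine ⟨b, hb, ?_⟩
  convert! hasExpansion_of_contDiff hb using 2 with k
  rw [hba]
  have := Nat.factorial_ne_zero k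
  field_simp

theorem HasExpansion.comp_pow {b : ℝ → ℝ} {a : ℕ → ℝ} (h : HasExpansion b a) {p : ℕ} (hp : p ≠ 0)
    (j N : ℕ) : (fun t => t ^ j * b (t ^ p) - ∑ k ∈ Finset.range N, a k * t ^ (p * k + j))
      =O[𝓝 0] fun t => t ^ (p * N) := by
  have h0 : Tendsto (fun t : ℝ => t ^ p) (𝓝 0) (𝓝 0) := by
    simpa [hp] using (continuous_pow p).tendsto (0 : ℝ)
  have h1 : (fun t : ℝ => t ^ j) =O[𝓝 0] fun _ => (1 : ℝ) :=
    ((continuous_pow j).tendsto (0 : ℝ)).isBigO_one ℝ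
  refine (h1.mul ((h N).comp_tendsto h0)).congr (fun t => ?_) fun t => ?_
  · simp only [Function.comp, mul_sub, Finset.mul_sum]
    congr 1
    refine Finset.sum_congr rfl fun k _ => ?_
    ring
  · simp [pow_mul]

/-! ### Decomposition of smooth functions by residue of the exponent -/

theorem hasDerivAt_abs_rpow {p : ℕ} (hp : p ≠ 0) {x : ℝ} (hx : x ≠ 0) :
    HasDerivAt (fun x : ℝ => |x| ^ (1 / p : ℝ)) (|x| ^ (1 / p : ℝ) / (p * x)) x := by
  have h1 : HasDerivAt (fun x : ℝ => |x|) (SignType.sign x : ℝ) x := hasDerivAt_abs hx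
  have h2 := h1.rpow_const (p := (1 / p : ℝ)) (Or.inl (abs_ne_zero.2 hx))
  convert! h2 using 1
  have hp' : (p : ℝ) ≠ 0 := by exact_mod_cast hp
  rw [Real.rpow_sub_one (abs_ne_zero.2 hx)]
  rcases lt_or_gt_of_ne hx with h | h
  · rw [abs_of_neg h, sign_neg h]; simp; field_simp
  · rw [abs_of_pos h, sign_pos h]; simp; field_simp

theorem pow_isBigO_pow {m n : ℕ} (h : m ≤ n) :
    (fun t : ℝ => t ^ n) =O[𝓝 0] fun t => t ^ m := by
  refine Asymptotics.IsBigO.of_bound 1 ?_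
  have := (continuous_abs.tendsto (0 : ℝ)).eventually (gt_mem_nhds (by simp : |(0 : ℝ)| < 1))
  filter_upwards [this] with t ht
  rw [norm_pow, norm_pow, one_mul, Real.norm_eq_abs]
  exact pow_le_pow_of_le_one (abs_nonneg t) ht.le h

/-- A smooth function splits as `A(s²) + s B(s²)` with `A` and `B` smooth (Whitney). The Taylor
coefficients of `A` and `B` are prescribed; the flat remainder is split into its even and odd part,
and these are functions of `s²` because flat functions may be composed with the square root. -/
theorem exists_eq_even_add_odd {M : ℝ → ℝ} (hM : ContDiff ℝ ∞ M) :
    ∃ A B : ℝ → ℝ, ContDiff ℝ ∞ A ∧ ContDiff ℝ ∞ B ∧ ∀ s, M s = A (s ^ 2) + s * B (s ^ 2) := by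
  have hMa := hasExpansion_of_contDiff hM
  set a : ℕ → ℝ := fun k => iteratedDeriv k M 0 / k.factorial
  obtain ⟨A, hA, hAa⟩ := exists_contDiff_hasExpansion fun k => a (2 * k)
  obtain ⟨B, hB, hBa⟩ := exists_contDiff_hasExpansion fun k => a (2 * k + 1)
  let R : ℝ → ℝ := fun s => M s - (A (s ^ 2) + s * B (s ^ 2))
  have hR : IsFlat R := by
    refine ⟨by fun_prop, fun N => ?_⟩
    have h1 := hMa (2 * N)
    have h2 := hAa.comp_pow two_ne_zero 0 N
    have h3 := hBa.comp_pow two_ne_zero 1 N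
    have hle := pow_isBigO_pow (show N ≤ 2 * N by omega)
    refine (((h1.sub h2).sub h3).congr_left fun t => ?_).trans hle
    have hsum : ∑ k ∈ Finset.range (2 * N), a k * t ^ k =
        ∑ k ∈ Finset.range N, a (2 * k) * t ^ (2 * k + 0) +
        ∑ k ∈ Finset.range N, a (2 * k + 1) * t ^ (2 * k + 1) := by
      clear * -
      induction N with
      | zero => simp
      | succ N ih =>
        rw [Nat.mul_succ, Finset.sum_range_succ, Finset.sum_range_succ, ih, Finset.sum_range_succ,
          Finset.sum_range_succ]
        ring
    rw [hsum]
    simp only [R]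
    ring
  let r : ℝ → ℝ := fun x => |x| ^ (1 / (2 : ℕ) : ℝ)
  have hr : ∀ x, x ≠ 0 → HasDerivAt r (r x / ((2 : ℕ) * x)) x := fun x hx =>
    hasDerivAt_abs_rpow two_ne_zero hx
  have hrabs : ∀ x, |r x| ^ 2 = |x| := fun x => by
    rw [abs_of_nonneg (Real.rpow_nonneg (abs_nonneg x) _)]
    rw [one_div, Real.rpow_inv_natCast_pow (abs_nonneg x) two_ne_zero]
  have hrsq : ∀ s, r (s ^ 2) = |s| := fun s => by
    simp only [r]
    rw [abs_pow, one_div, Real.pow_rpow_inv_natCast (abs_nonneg s) two_ne_zero]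
  have hE : IsFlat fun t => (1 / 2) * (R t + R (-t)) := (hR.add hR.comp_neg).smul _
  have hO : IsFlat fun t => t * ((1 / 2) * (R t + (-1) * R (-t))) :=
    ((hR.add (hR.comp_neg.smul _)).smul _).id_mul
  have hE' := hE.contDiff_inv_pow_mul_comp hr hrabs two_ne_zero 0
  have hO' := hO.contDiff_inv_pow_mul_comp hr hrabs two_ne_zero 1
  refine ⟨_, _, hA.add hE', hB.add hO', fun s => ?_⟩
  have hMR : M s = A (s ^ 2) + s * B (s ^ 2) + R s := by simp only [R]; ring
  rw [hMR, hrsq]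
  by_cases hs : s = 0
  · simp [hs, hR.zero]
  rcases le_or_gt 0 s with h | h
  · rw [abs_of_nonneg h]; field_simp; ring
  · rw [abs_of_neg h, neg_neg]; field_simp; ring

/-- A smooth function splits as `A(s³) + s B(s³) + s² C(s³)` with `A`, `B`, `C` smooth. As the cube
root is defined on the whole line, the flat remainder `R` is absorbed into `A`, as `R(∛x)`. -/
theorem exists_eq_cubic_decomposition {M : ℝ → ℝ} (hM : ContDiff ℝ ∞ M) :
    ∃ A B C : ℝ → ℝ, ContDiff ℝ ∞ A ∧ ContDiff ℝ ∞ B ∧ ContDiff ℝ ∞ C ∧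
      ∀ s, M s = A (s ^ 3) + s * B (s ^ 3) + s ^ 2 * C (s ^ 3) := by
  have hMa := hasExpansion_of_contDiff hM
  set a : ℕ → ℝ := fun k => iteratedDeriv k M 0 / k.factorial
  obtain ⟨A, hA, hAa⟩ := exists_contDiff_hasExpansion fun k => a (3 * k)
  obtain ⟨B, hB, hBa⟩ := exists_contDiff_hasExpansion fun k => a (3 * k + 1)
  obtain ⟨C, hC, hCa⟩ := exists_contDiff_hasExpansion fun k => a (3 * k + 2)
  let R : ℝ → ℝ := fun s => M s - (A (s ^ 3) + s * B (s ^ 3) + s ^ 2 * C (s ^ 3))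
  have hR : IsFlat R := by
    refine ⟨by fun_prop, fun N => ?_⟩
    have h1 := hMa (3 * N)
    have h2 := hAa.comp_pow three_ne_zero 0 N
    have h3 := hBa.comp_pow three_ne_zero 1 N
    have h4 := hCa.comp_pow three_ne_zero 2 N
    have hle := pow_isBigO_pow (show N ≤ 3 * N by omega)
    refine ((((h1.sub h2).sub h3).sub h4).congr_left fun t => ?_).trans hle
    have hsum : ∑ k ∈ Finset.range (3 * N), a k * t ^ k =
        ∑ k ∈ Finset.range N, a (3 * k) * t ^ (3 * k + 0) +
        ∑ k ∈ Finset.range N, a (3 * k + 1) * t ^ (3 * k + 1) +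
        ∑ k ∈ Finset.range N, a (3 * k + 2) * t ^ (3 * k + 2) := by
      clear * -
      induction N with
      | zero => simp
      | succ N ih =>
        rw [Nat.mul_succ, Finset.sum_range_succ, Finset.sum_range_succ, Finset.sum_range_succ, ih,
          Finset.sum_range_succ, Finset.sum_range_succ, Finset.sum_range_succ]
        ring
    rw [hsum]
    simp only [R]
    ring
  let r : ℝ → ℝ := fun x => (SignType.sign x : ℝ) * |x| ^ (1 / (3 : ℕ) : ℝ)
  have hr : ∀ x, x ≠ 0 → HasDerivAt r (r x / ((3 : ℕ) * x)) x := fun x hx => by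
    have h1 := (hasDerivAt_abs_rpow three_ne_zero hx).const_mul (SignType.sign x : ℝ)
    rw [← mul_div_assoc] at h1
    refine h1.congr_of_eventuallyEq ?_
    rcases lt_or_gt_of_ne hx with h | h
    · filter_upwards [gt_mem_nhds h] with y hy
      simp only [r]
      rw [sign_neg h, sign_neg hy]
    · filter_upwards [lt_mem_nhds h] with y hy
      simp only [r]
      rw [sign_pos h, sign_pos hy]
  have hrcub : ∀ s, r (s ^ 3) = s := fun s => by
    simp only [r]
    rw [abs_pow, one_div, Real.pow_rpow_inv_natCast (abs_nonneg s) three_ne_zero]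
    rcases lt_trichotomy s 0 with h | h | h
    · rw [sign_neg (Odd.pow_neg (by decide) h), abs_of_neg h]; simp
    · simp [h]
    · rw [sign_pos (pow_pos h 3), abs_of_pos h]; simp
  have hrabs : ∀ x, |r x| ^ 3 = |x| := fun x => by
    have h1 : |r x| = |x| ^ (1 / (3 : ℕ) : ℝ) := by
      have h2 := Real.rpow_nonneg (abs_nonneg x) (1 / (3 : ℕ) : ℝ)
      simp only [r]
      rw [abs_mul, abs_of_nonneg h2]
      rcases lt_trichotomy x 0 with h | h | h
      · simp [sign_neg h]
      · simp [h]
      · simp [sign_pos h]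
    rw [h1, one_div, Real.rpow_inv_natCast_pow (abs_nonneg x) three_ne_zero]
  have hR' := hR.contDiff_inv_pow_mul_comp hr hrabs three_ne_zero 0
  refine ⟨_, B, C, hA.add hR', hB, hC, fun s => ?_⟩
  rw [hrcub]
  simp only [R]
  simp
  ring

/-! ### Normal forms of cusps -/

/-- Inverse function theorem: near a point with invertible derivative a smooth map is a local
diffeomorphism, smooth in both directions on the whole of its source and target. -/
theorem exists_openPartialHomeomorph {E : Type*} [NormedAddCommGroup E] [NormedSpace ℝ E]
    [CompleteSpace E] {G : E → E} (hG : ContDiff ℝ ∞ G) {G' : E ≃L[ℝ] E} {a : E}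
    (h : HasFDerivAt G (G' : E →L[ℝ] E) a) :
    ∃ e : OpenPartialHomeomorph E E, a ∈ e.source ∧ (∀ x, e x = G x) ∧
      ContDiffOn ℝ ∞ e e.source ∧ ContDiffOn ℝ ∞ e.symm e.target := by
  let S : Set E := {x | fderiv ℝ G x ∈ range ((↑) : (E ≃L[ℝ] E) → E →L[ℝ] E)}
  have hS : IsOpen S := ContinuousLinearEquiv.isOpen.preimage (hG.continuous_fderiv (by simp))
  let e₀ := hG.contDiffAt.toOpenPartialHomeomorph G h (by simp)
  let e := e₀.restrOpen S hS
  have he : ∀ x, e x = G x := fun x => rfl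
  refine ⟨e, ⟨ContDiffAt.mem_toOpenPartialHomeomorph_source _ h _, G', h.fderiv.symm⟩, he,
    hG.contDiffOn, fun y hy => ?_⟩
  obtain ⟨A, hA⟩ : e.symm y ∈ S := (e.map_target hy).2
  have hd : HasFDerivAt e (A : E →L[ℝ] E) (e.symm y) := by
    rw [hA]
    exact (hG.differentiable (by simp) _).hasFDerivAt
  exact (e.contDiffAt_symm hy hd hG.contDiffAt).contDiffWithinAt

/-- Every smooth germ is a smooth function of a given local coordinate `τ`. -/
theorem exists_comp_eventuallyEq {τ N : ℝ → ℝ} (hτ : ContDiff ℝ ∞ τ) (hN : ContDiff ℝ ∞ N)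
    (h0 : τ 0 = 0) (h1 : deriv τ 0 ≠ 0) :
    ∃ N' : ℝ → ℝ, ContDiff ℝ ∞ N' ∧ ∀ᶠ s in 𝓝 0, N s = N' (τ s) := by
  have hd : HasFDerivAt τ ((ContinuousLinearEquiv.unitsEquivAut ℝ (Units.mk0 _ h1) :
      ℝ ≃L[ℝ] ℝ) : ℝ →L[ℝ] ℝ) 0 := by
    have := (hτ.differentiable (by simp) 0).hasDerivAt.hasFDerivAt
    convert! this using 1
  obtain ⟨e, he0, he, -, hes⟩ := exists_openPartialHomeomorph hτ hd
  have ht : e.target ∈ 𝓝 (0 : ℝ) := by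
    refine e.open_target.mem_nhds ?_
    have := e.map_source he0
    rwa [he, h0] at this
  obtain ⟨N', hN', hEq⟩ := exists_contDiff_eventuallyEq ht (hN.comp_contDiffOn hes)
  refine ⟨N', hN', ?_⟩
  have hlim : Tendsto τ (𝓝 0) (𝓝 0) := by simpa [h0] using hτ.continuous.tendsto 0
  filter_upwards [hlim.eventually hEq, e.open_source.mem_nhds he0] with s hs hs'
  rw [hs, Function.comp, ← he, e.left_inv hs']

theorem exists_pow_eq {u : ℝ → ℝ} (hu : ContDiff ℝ ∞ u) (h0 : u 0 = 1) {p : ℕ} (hp : p ≠ 0) :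
    ∃ ρ : ℝ → ℝ, ContDiff ℝ ∞ ρ ∧ ρ 0 = 1 ∧ ∀ᶠ s in 𝓝 0, ρ s ^ p = u s := by
  have hpos : {s | 0 < u s} ∈ 𝓝 (0 : ℝ) :=
    (isOpen_lt continuous_const hu.continuous).mem_nhds (by simp [h0])
  obtain ⟨ρ, hρ, hEq⟩ := exists_contDiff_eventuallyEq (f := fun s => u s ^ (p : ℝ)⁻¹) hpos
    (hu.contDiffOn.rpow_const_of_ne fun x hx => (show 0 < u x from hx).ne')
  refine ⟨ρ, hρ, by rw [hEq.self_of_nhds]; simp [h0], ?_⟩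
  filter_upwards [hEq, hpos] with s hs hs'
  rw [hs, Real.rpow_inv_natCast_pow (le_of_lt hs') hp]

theorem exists_mul_eq_one {ρ : ℝ → ℝ} (hρ : ContDiff ℝ ∞ ρ) (h0 : ρ 0 ≠ 0) :
    ∃ q : ℝ → ℝ, ContDiff ℝ ∞ q ∧ ∀ᶠ s in 𝓝 0, ρ s * q s = 1 := by
  have hne : {s | ρ s ≠ 0} ∈ 𝓝 (0 : ℝ) :=
    (isOpen_ne_fun hρ.continuous continuous_const).mem_nhds h0
  obtain ⟨q, hq, hEq⟩ := exists_contDiff_eventuallyEq (f := fun s => (ρ s)⁻¹) hne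
    (hρ.contDiffOn.inv fun x hx => hx)
  refine ⟨q, hq, ?_⟩
  filter_upwards [hEq, hne] with s hs hs'
  rw [hs]
  exact mul_inv_cancel₀ hs'

/-- The curve `(X, Y) = (sⁱ u(s), sʲ v(s))` is brought to the form `X + α Y = κ τⁱ`,
`Y = g(τⁱ, τʲ)` by a new parameter `τ = φ(s)`, where `∂g = (0, b)` at the origin and `κ`, `b` are
not `0`. Then `(X, Y)` is the image of `(τⁱ, τʲ)` under a diffeomorphism germ. -/
def HasNormalForm (i j : ℕ) (u v : ℝ → ℝ) : Prop :=
  ∃ (φ : ℝ → ℝ) (g : ℝ × ℝ → ℝ) (α κ b : ℝ), ContDiff ℝ ∞ φ ∧ φ 0 = 0 ∧ deriv φ 0 ≠ 0 ∧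
    ContDiff ℝ ∞ g ∧ g 0 = 0 ∧ HasFDerivAt g (b • ContinuousLinearMap.snd ℝ ℝ ℝ) 0 ∧
    κ ≠ 0 ∧ b ≠ 0 ∧ ∀ᶠ s in 𝓝 0, s ^ i * u s + α * (s ^ j * v s) = κ * φ s ^ i ∧
      s ^ j * v s = g (φ s ^ i, φ s ^ j)

/-- With `s² u(s) = u(0) τ²` one has `s³ v(s) = τ³ N(τ)`, and `N(τ) = A(τ²) + τ B(τ²)` gives
`g(x, w) = w A(x) + x² B(x)`. -/
theorem hasNormalForm_two_three {u v : ℝ → ℝ} (hu : ContDiff ℝ ∞ u) (hv : ContDiff ℝ ∞ v)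
    (hu0 : u 0 ≠ 0) (hv0 : v 0 ≠ 0) :
    HasNormalForm 2 3 u v := by
  obtain ⟨ρ, hρ, hρ0, hρu⟩ := exists_pow_eq (u := fun s => u s / u 0) (by fun_prop)
    (div_self hu0) two_ne_zero
  obtain ⟨q, hq, hρq⟩ := exists_mul_eq_one hρ (by simp [hρ0])
  have hτ : ContDiff ℝ ∞ fun s => s * ρ s := contDiff_id.mul hρ
  have hτ' : deriv (fun s => s * ρ s) 0 = 1 := by
    have := ((hasDerivAt_id' (0 : ℝ)).fun_mul (hρ.differentiable (by simp) 0).hasDerivAt).deriv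
    rw [this]; simp [hρ0]
  obtain ⟨N, hN, hNτ⟩ := exists_comp_eventuallyEq hτ (N := fun s => v s * q s ^ 3) (by fun_prop)
    (by simp) (by simp [hτ'])
  obtain ⟨A, B, hA, hB, hAB⟩ := exists_eq_even_add_odd hN
  have hq0 : q 0 = 1 := by simpa [hρ0] using hρq.self_of_nhds
  have hA0 : A 0 = v 0 := by
    have h1 := hNτ.self_of_nhds
    have h2 := hAB 0
    simp [hq0] at h1 h2
    rw [← h2, ← h1]
  refine ⟨_, fun x => x.2 * A x.1 + x.1 ^ 2 * B x.1, 0, u 0, v 0, hτ, by simp, by simp [hτ'],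
    by fun_prop, by simp, ?_, hu0, hv0, ?_⟩
  · have hA' : HasFDerivAt (fun x : ℝ × ℝ => A x.1) (fderiv ℝ (fun x : ℝ × ℝ => A x.1) 0) 0 :=
      (ContDiff.differentiable (by fun_prop : ContDiff ℝ ∞ fun x : ℝ × ℝ => A x.1)
        (by simp) 0).hasFDerivAt
    have hB' : HasFDerivAt (fun x : ℝ × ℝ => B x.1) (fderiv ℝ (fun x : ℝ × ℝ => B x.1) 0) 0 :=
      (ContDiff.differentiable (by fun_prop : ContDiff ℝ ∞ fun x : ℝ × ℝ => B x.1)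
        (by simp) 0).hasFDerivAt
    have := (hasFDerivAt_snd.mul hA').add (((hasFDerivAt_fst (𝕜 := ℝ) (p := (0 : ℝ × ℝ))).pow 2).mul
      hB')
    convert! this using 1
    simp [hA0]
  · filter_upwards [hρu, hρq, hNτ] with s h1 h2 h3
    refine ⟨?_, ?_⟩
    · rw [zero_mul, add_zero, mul_pow, h1]; field_simp
    · have h4 : v s = ρ s ^ 3 * (v s * q s ^ 3) := by
        rw [mul_left_comm, ← mul_pow, h2]; ring
      rw [h4, h3, hAB]
      ring

/-- With `s³ u(s) + α s⁴ v(s) = u(0) τ³` one has `s⁴ v(s) = τ⁴ K(τ)`. For a suitable `α` the linear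
term of `K` vanishes, so that `s⁴ v(s) = K(0) τ⁴ + τ⁶ N(τ)`. Now `N(τ) = A(τ³) + τ B(τ³) + τ² C(τ³)`
gives `g(x, w) = K(0) w + x² A(x) + x w B(x) + w² C(x)`. -/
theorem hasNormalForm_three_four {u v : ℝ → ℝ} (hu : ContDiff ℝ ∞ u) (hv : ContDiff ℝ ∞ v)
    (hu0 : u 0 ≠ 0) (hv0 : v 0 ≠ 0) :
    HasNormalForm 3 4 u v := by
  have hu' := (hu.differentiable (by simp) 0).hasDerivAt
  have hv' := (hv.differentiable (by simp) 0).hasDerivAt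
  -- the value for which the quintic term of `s⁴ v(s)`, as a function of `τ`, vanishes
  let α : ℝ := (3 * u 0 * deriv v 0 / (4 * v 0) - deriv u 0) / v 0
  obtain ⟨ρ, hρ, hρ0, hρu⟩ := exists_pow_eq (u := fun s => (u s + α * (s * v s)) / u 0)
    (by fun_prop) (by simp [hu0]) three_ne_zero
  obtain ⟨q, hq, hρq⟩ := exists_mul_eq_one hρ (by simp [hρ0])
  have hρ' := (hρ.differentiable (by simp) 0).hasDerivAt
  have hq' := (hq.differentiable (by simp) 0).hasDerivAt
  have hq0 : q 0 = 1 := by simpa [hρ0] using hρq.self_of_nhds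
  have hρd : 3 * deriv ρ 0 = (deriv u 0 + α * v 0) / u 0 := by
    have h1 := hρ'.fun_pow 3
    have h2 := ((hu'.add (((hasDerivAt_id' (0 : ℝ)).fun_mul hv').const_mul α)).div_const (u 0))
    have h3 := (h1.congr_of_eventuallyEq (EventuallyEq.symm hρu)).unique h2
    simpa [hρ0] using h3
  have hqd : deriv ρ 0 + deriv q 0 = 0 := by
    have h1 := hρ'.fun_mul hq'
    have h2 := (h1.congr_of_eventuallyEq (EventuallyEq.symm hρq)).unique (hasDerivAt_const _ _)
    simpa [hρ0, hq0] using h2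
  have hτ : ContDiff ℝ ∞ fun s => s * ρ s := contDiff_id.mul hρ
  have hτ' : deriv (fun s => s * ρ s) 0 = 1 := by
    have := ((hasDerivAt_id' (0 : ℝ)).fun_mul hρ').deriv
    rw [this]; simp [hρ0]
  have hK' : HasDerivAt (fun s => v s * q s ^ 4 - v 0) 0 0 := by
    have h1 := (hv'.fun_mul (hq'.fun_pow 4)).sub_const (v 0)
    convert! h1 using 1
    have h2 : deriv q 0 = -(deriv u 0 + α * v 0) / (3 * u 0) := by
      have : deriv q 0 = - deriv ρ 0 := by linarith
      rw [this]
      field_simp at hρd ⊢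
      linarith
    rw [h2, hq0]
    simp only [α]
    field_simp
    ring
  obtain ⟨K₁, hK₁, hK₁0, hKK₁⟩ := exists_contDiff_eq_mul (f := fun s => v s * q s ^ 4 - v 0)
    (by fun_prop) (by simp [hq0])
  obtain ⟨M, hM, -, hKM⟩ := exists_contDiff_eq_mul hK₁ (by rw [hK₁0, hK'.deriv])
  obtain ⟨N, hN, hNτ⟩ := exists_comp_eventuallyEq hτ (N := fun s => M s * q s ^ 2) (by fun_prop)
    (by simp) (by simp [hτ'])
  obtain ⟨A, B, C, hA, hB, hC, hABC⟩ := exists_eq_cubic_decomposition hN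
  refine ⟨_, fun x => v 0 * x.2 + x.1 ^ 2 * A x.1 + x.2 * (x.1 * B x.1) + x.2 ^ 2 * C x.1,
    α, u 0, v 0, hτ, by simp, by simp [hτ'], by fun_prop, by simp, ?_, hu0, hv0, ?_⟩
  · have hd : ∀ {A : ℝ → ℝ}, ContDiff ℝ ∞ A →
        HasFDerivAt (fun x : ℝ × ℝ => A x.1) (fderiv ℝ (fun x : ℝ × ℝ => A x.1) 0) 0 := fun hA =>
      (ContDiff.differentiable (by fun_prop : ContDiff ℝ ∞ fun x : ℝ × ℝ => _)
        (by simp) 0).hasFDerivAt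
    have hf := hasFDerivAt_fst (𝕜 := ℝ) (p := (0 : ℝ × ℝ))
    have hs := hasFDerivAt_snd (𝕜 := ℝ) (p := (0 : ℝ × ℝ))
    have := (((hs.const_mul (v 0)).add ((hf.pow 2).mul (hd hA))).add
      (hs.mul (hf.mul (hd hB)))).add ((hs.pow 2).mul (hd hC))
    convert! this using 1
    simp
  · filter_upwards [hρu, hρq, hNτ] with s h1 h2 h3
    refine ⟨?_, ?_⟩
    · rw [mul_pow, h1]; field_simp
    · have h4 : v s = ρ s ^ 4 * (v s * q s ^ 4) := by
        rw [mul_left_comm, ← mul_pow, h2]; ring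
      have h5 : v s * q s ^ 4 = v 0 + s ^ 2 * M s := by
        have := hKK₁ s
        rw [hKM] at this
        linear_combination this
      have h6 : M s = ρ s ^ 2 * (M s * q s ^ 2) := by
        rw [mul_left_comm, ← mul_pow, h2]; ring
      rw [h4, h5, h6, h3, hABC]
      ring

/-- The condition of `Horocyclic.HasCusp` for a curve in the plane. -/
def HasPlanarCusp (i j : ℕ) (J : Set ℝ) (C : ℝ → ℝ × ℝ) (t₀ : ℝ) : Prop :=
  ∃ (φ : OpenPartialHomeomorph ℝ ℝ) (Ψ : OpenPartialHomeomorph (ℝ × ℝ) (ℝ × ℝ)),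
    t₀ ∈ φ.source ∧ φ t₀ = 0 ∧
    ContDiffOn ℝ ∞ φ φ.source ∧ ContDiffOn ℝ ∞ φ.symm φ.target ∧
    C t₀ ∈ Ψ.source ∧ Ψ (C t₀) = (0, 0) ∧
    ContDiffOn ℝ ∞ Ψ Ψ.source ∧ ContDiffOn ℝ ∞ Ψ.symm Ψ.target ∧
    ∀ᶠ t in 𝓝[J] t₀, C t ∈ Ψ.source ∧ Ψ (C t) = (φ t ^ i, φ t ^ j)

/-- An `(i, j)`-cusp from a presentation of the curve as the image of the model under a smooth map
with invertible derivative. -/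
theorem hasPlanarCusp_of_eventually_eq {i j : ℕ} (hi : i ≠ 0) (hj : j ≠ 0) {J : Set ℝ}
    {C : ℝ → ℝ × ℝ} {t₀ : ℝ} (ht₀ : t₀ ∈ J) {φ : ℝ → ℝ} (hφ : ContDiff ℝ ∞ φ) (hφ0 : φ t₀ = 0)
    (hφ' : deriv φ t₀ ≠ 0) {F : ℝ × ℝ → ℝ × ℝ} (hF : ContDiff ℝ ∞ F)
    {F' : (ℝ × ℝ) ≃L[ℝ] (ℝ × ℝ)} (hFF' : HasFDerivAt F (F' : ℝ × ℝ →L[ℝ] ℝ × ℝ) 0)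
    (hC : ∀ᶠ t in 𝓝[J] t₀, C t = F (φ t ^ i, φ t ^ j)) : HasPlanarCusp i j J C t₀ := by
  have hd : HasFDerivAt φ ((ContinuousLinearEquiv.unitsEquivAut ℝ (Units.mk0 _ hφ') :
      ℝ ≃L[ℝ] ℝ) : ℝ →L[ℝ] ℝ) t₀ := by
    have := (hφ.differentiable (by simp) t₀).hasDerivAt.hasFDerivAt
    convert! this using 1
  obtain ⟨e, he₀, he, hes, hes'⟩ := exists_openPartialHomeomorph hφ hd
  obtain ⟨Φ, hΦ₀, hΦ, hΦs, hΦs'⟩ := exists_openPartialHomeomorph hF hFF'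
  have hC₀ : C t₀ = F 0 := by
    have := hC.self_of_nhdsWithin ht₀
    rw [this, hφ0, zero_pow hi, zero_pow hj]; rfl
  have hlim : Tendsto (fun t => (φ t ^ i, φ t ^ j)) (𝓝 t₀) (𝓝 0) := by
    have : Continuous fun t => (φ t ^ i, φ t ^ j) := by
      have := hφ.continuous
      fun_prop
    have := this.tendsto t₀
    rw [hφ0, zero_pow hi, zero_pow hj] at this
    exact this
  refine ⟨e, Φ.symm, he₀, by rw [he, hφ0], hes, hes', ?_, ?_, hΦs', by simpa using hΦs, ?_⟩
  · rw [hC₀, ← hΦ]; exact Φ.map_source hΦ₀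
  · rw [hC₀, ← hΦ, Φ.left_inv hΦ₀]; rfl
  · filter_upwards [hC, (hlim.eventually (Φ.open_source.mem_nhds hΦ₀)).filter_mono
      nhdsWithin_le_nhds] with t ht ht'
    rw [ht, ← hΦ, he]
    exact ⟨Φ.map_source ht', Φ.left_inv ht'⟩

theorem exists_continuousLinearEquiv_of_det_ne_zero {a b c d : ℝ} (h : a * d - b * c ≠ 0) :
    ∃ A : (ℝ × ℝ) ≃L[ℝ] (ℝ × ℝ), (A : ℝ × ℝ →L[ℝ] ℝ × ℝ) =
      (a • ContinuousLinearMap.fst ℝ ℝ ℝ + b • ContinuousLinearMap.snd ℝ ℝ ℝ).prod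
        (c • ContinuousLinearMap.fst ℝ ℝ ℝ + d • ContinuousLinearMap.snd ℝ ℝ ℝ) := by
  obtain ⟨D, hD⟩ : ∃ D, D = a * d - b * c := ⟨_, rfl⟩
  rw [← hD] at h
  refine ⟨ContinuousLinearEquiv.equivOfInverse
    ((a • ContinuousLinearMap.fst ℝ ℝ ℝ + b • ContinuousLinearMap.snd ℝ ℝ ℝ).prod
      (c • ContinuousLinearMap.fst ℝ ℝ ℝ + d • ContinuousLinearMap.snd ℝ ℝ ℝ))
    (((d / D) • ContinuousLinearMap.fst ℝ ℝ ℝ + (-b / D) • ContinuousLinearMap.snd ℝ ℝ ℝ).prod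
      ((-c / D) • ContinuousLinearMap.fst ℝ ℝ ℝ + (a / D) • ContinuousLinearMap.snd ℝ ℝ ℝ))
    ?_ ?_, rfl⟩
  · rintro ⟨x, y⟩
    ext <;> simp <;> field_simp
    · linear_combination -x * hD
    · linear_combination -y * hD
  · rintro ⟨x, y⟩
    ext <;> simp <;> field_simp
    · linear_combination -x * hD
    · linear_combination -y * hD

theorem hasPlanarCusp_of_hasNormalForm {i j : ℕ} (hi : i ≠ 0) (hj : j ≠ 0) {u v : ℝ → ℝ}
    (huv : HasNormalForm i j u v) {J : Set ℝ} {C : ℝ → ℝ × ℝ} {t₀ : ℝ} (ht₀ : t₀ ∈ J)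
    {p e₁ e₂ : ℝ × ℝ} (he : e₁.1 * e₂.2 - e₁.2 * e₂.1 ≠ 0)
    (hC : ∀ᶠ t in 𝓝[J] t₀, C t =
      p + ((t - t₀) ^ i * u (t - t₀)) • e₁ + ((t - t₀) ^ j * v (t - t₀)) • e₂) :
    HasPlanarCusp i j J C t₀ := by
  obtain ⟨φ, g, α, κ, b, hφ, hφ0, hφ', hg, hg0, hg', hκ, hb, huv⟩ := huv
  let F : ℝ × ℝ → ℝ × ℝ := fun x =>
    (p.1 + (κ * x.1 - α * g x) * e₁.1 + g x * e₂.1, p.2 + (κ * x.1 - α * g x) * e₁.2 + g x * e₂.2)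
  obtain ⟨F', hF'⟩ := exists_continuousLinearEquiv_of_det_ne_zero
    (a := κ * e₁.1) (b := b * (e₂.1 - α * e₁.1)) (c := κ * e₁.2) (d := b * (e₂.2 - α * e₁.2)) (by
      have : κ * e₁.1 * (b * (e₂.2 - α * e₁.2)) - b * (e₂.1 - α * e₁.1) * (κ * e₁.2) =
        κ * b * (e₁.1 * e₂.2 - e₁.2 * e₂.1) := by ring
      rw [this]
      exact mul_ne_zero (mul_ne_zero hκ hb) he)
  have hFF' : HasFDerivAt F (F' : ℝ × ℝ →L[ℝ] ℝ × ℝ) 0 := by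
    have hf := hasFDerivAt_fst (𝕜 := ℝ) (p := (0 : ℝ × ℝ))
    have hX := (hf.const_mul κ).sub (hg'.const_mul α)
    have h1 := ((hX.mul_const e₁.1).const_add p.1).add (hg'.mul_const e₂.1)
    have h2 := ((hX.mul_const e₁.2).const_add p.2).add (hg'.mul_const e₂.2)
    rw [hF']
    convert! h1.prodMk h2 using 1
    ext <;> simp <;> ring
  have hd : deriv (fun t => φ (t - t₀)) t₀ = deriv φ 0 := by
    rw [deriv_comp_sub_const, sub_self]
  refine hasPlanarCusp_of_eventually_eq hi hj ht₀ (φ := fun t => φ (t - t₀)) (by fun_prop)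
    (by simp [hφ0]) (by rwa [hd]) (F := F) (by fun_prop) hFF' ?_
  have hlim : Tendsto (fun t => t - t₀) (𝓝[J] t₀) (𝓝 0) := by
    have : Tendsto (fun t => t - t₀) (𝓝 t₀) (𝓝 (t₀ - t₀)) :=
      (continuous_sub_right t₀).tendsto t₀
    rw [sub_self] at this
    exact this.mono_left nhdsWithin_le_nhds
  filter_upwards [hC, hlim.eventually huv] with t h1 h2
  obtain ⟨h2, h3⟩ := h2
  rw [h1]
  have h4 : (t - t₀) ^ i * u (t - t₀) =
      κ * φ (t - t₀) ^ i - α * g (φ (t - t₀) ^ i, φ (t - t₀) ^ j) := by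
    rw [← h3, ← h2]; ring
  rw [h4, h3]
  ext <;> simp [F]

theorem eventually_eq_of_hasDerivWithinAt_zero {J : Set ℝ} (hJ : J.OrdConnected) {D : ℝ → ℝ}
    {t₀ : ℝ} (ht₀ : t₀ ∈ J) (h : ∀ᶠ t in 𝓝[J] t₀, HasDerivWithinAt D 0 J t) :
    ∀ᶠ t in 𝓝[J] t₀, D t = D t₀ := by
  obtain ⟨δ, hδ, hball⟩ := Metric.mem_nhdsWithin_iff.1 h
  have hconv : Convex ℝ (Metric.ball t₀ δ ∩ J) := (convex_ball t₀ δ).inter hJ.convex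
  filter_upwards [inter_mem (mem_nhdsWithin_of_mem_nhds (Metric.ball_mem_nhds t₀ hδ))
    self_mem_nhdsWithin] with t ht
  have := hconv.norm_image_sub_le_of_norm_hasDerivWithin_le (f := D) (f' := fun _ => 0) (C := 0)
    (fun s hs => (show HasDerivWithinAt D 0 J s from hball hs).mono inter_subset_right)
    (by simp) ⟨Metric.mem_ball_self hδ, ht₀⟩ ht
  rw [zero_mul, norm_le_zero_iff, sub_eq_zero] at this
  exact this

/-- If `C' = h w`, where `h` vanishes to order `k` at `t₀` and `w`, `w'` are independent there, then in
the coordinates of the basis `w(t₀)`, `w'(t₀)` the curve is `(sᵏ⁺¹ u(s), sᵏ⁺² v(s))`, `s = t - t₀`,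
with `u(0)` and `v(0)` not `0`. -/
theorem exists_adapted_coordinates {J : Set ℝ} (hJ : J.OrdConnected) (hJ' : J.Nontrivial)
    {t₀ : ℝ} (ht₀ : t₀ ∈ J) {C₁ C₂ h w₁ w₂ h₁ : ℝ → ℝ} {k : ℕ}
    (hC₁ : ∀ t ∈ J, HasDerivWithinAt C₁ (h t * w₁ t) J t)
    (hC₂ : ∀ t ∈ J, HasDerivWithinAt C₂ (h t * w₂ t) J t)
    (hw₁ : ContDiffOn ℝ ∞ w₁ J) (hw₂ : ContDiffOn ℝ ∞ w₂ J) (hh₁ : ContDiff ℝ ∞ h₁)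
    (hh₁0 : h₁ 0 ≠ 0) (hh : ∀ᶠ t in 𝓝[J] t₀, h t = (t - t₀) ^ k * h₁ (t - t₀))
    (hw : w₁ t₀ * derivWithin w₂ J t₀ - w₂ t₀ * derivWithin w₁ J t₀ ≠ 0) :
    ∃ u v : ℝ → ℝ, ContDiff ℝ ∞ u ∧ ContDiff ℝ ∞ v ∧ u 0 ≠ 0 ∧ v 0 ≠ 0 ∧
      ∀ᶠ t in 𝓝[J] t₀, (C₁ t, C₂ t) = (C₁ t₀, C₂ t₀) +
        ((t - t₀) ^ (k + 1) * u (t - t₀)) • (w₁ t₀, w₂ t₀) +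
        ((t - t₀) ^ (k + 2) * v (t - t₀)) • (derivWithin w₁ J t₀, derivWithin w₂ J t₀) := by
  have hud := uniqueDiffOn_of_ordConnected hJ hJ' t₀ ht₀
  obtain ⟨W₁, hW₁, hWw₁⟩ := exists_contDiff_eventuallyEq_nhdsWithin hJ hJ' hw₁ ht₀
  obtain ⟨W₂, hW₂, hWw₂⟩ := exists_contDiff_eventuallyEq_nhdsWithin hJ hJ' hw₂ ht₀
  have hval₁ : W₁ t₀ = w₁ t₀ := hWw₁.self_of_nhdsWithin ht₀
  have hval₂ : W₂ t₀ = w₂ t₀ := hWw₂.self_of_nhdsWithin ht₀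
  have hd₁ : deriv W₁ t₀ = derivWithin w₁ J t₀ := by
    rw [← hWw₁.derivWithin_eq hval₁]
    exact ((hW₁.differentiable (by simp) t₀).derivWithin hud).symm
  have hd₂ : deriv W₂ t₀ = derivWithin w₂ J t₀ := by
    rw [← hWw₂.derivWithin_eq hval₂]
    exact ((hW₂.differentiable (by simp) t₀).derivWithin hud).symm
  rw [← hd₁, ← hd₂, ← hval₁, ← hval₂] at hw ⊢
  set Δ := W₁ t₀ * deriv W₂ t₀ - W₂ t₀ * deriv W₁ t₀ with hΔ
  -- coordinates of `w` in the basis `w t₀`, `w' t₀`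
  let a : ℝ → ℝ := fun s => (W₁ (t₀ + s) * deriv W₂ t₀ - W₂ (t₀ + s) * deriv W₁ t₀) / Δ
  let b : ℝ → ℝ := fun s => (W₁ t₀ * W₂ (t₀ + s) - W₂ t₀ * W₁ (t₀ + s)) / Δ
  have ha : ContDiff ℝ ∞ a := by fun_prop
  have hb : ContDiff ℝ ∞ b := by fun_prop
  have ha0 : a 0 = 1 := by simp only [a, add_zero]; exact div_self hw
  have hb0 : b 0 = 0 := by simp only [b, add_zero]; ring
  have hb' : deriv b 0 = 1 := by
    have e₁ : HasDerivAt (fun s => W₁ (t₀ + s)) (deriv W₁ t₀) 0 := by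
      have := (hW₁.differentiable (by simp) (t₀ + 0)).hasDerivAt.comp_const_add t₀ 0
      simpa using this
    have e₂ : HasDerivAt (fun s => W₂ (t₀ + s)) (deriv W₂ t₀) 0 := by
      have := (hW₂.differentiable (by simp) (t₀ + 0)).hasDerivAt.comp_const_add t₀ 0
      simpa using this
    have := (((e₂.const_mul (W₁ t₀)).sub (e₁.const_mul (W₂ t₀))).div_const Δ).deriv
    exact this.trans (div_self hw)
  obtain ⟨b₁, hb₁, hb₁0, hbb₁⟩ := exists_contDiff_eq_mul hb hb0
  obtain ⟨u, hu, hu0, hud⟩ := exists_contDiff_hasDerivAt_pow_mul (hh₁.mul ha) k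
  obtain ⟨v, hv, hv0, hvd⟩ := exists_contDiff_hasDerivAt_pow_mul (hh₁.mul hb₁) (k + 1)
  refine ⟨u, v, hu, hv, ?_, ?_, ?_⟩
  · rw [hu0]; simp only [ha0, mul_one]; positivity
  · rw [hv0]; simp only [hb₁0, hb', mul_one]; positivity
  have key : ∀ {C w W : ℝ → ℝ}, (∀ t ∈ J, HasDerivWithinAt C (h t * w t) J t) →
      (W =ᶠ[𝓝[J] t₀] w) → (∀ t, W t = a (t - t₀) * W t₀ + b (t - t₀) * deriv W t₀) →
      ∀ᶠ t in 𝓝[J] t₀, C t = C t₀ + (t - t₀) ^ (k + 1) * u (t - t₀) * W t₀ +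
        (t - t₀) ^ (k + 2) * v (t - t₀) * deriv W t₀ := by
    intro C w W hC hWw hab
    have := eventually_eq_of_hasDerivWithinAt_zero hJ ht₀ (D := fun t => C t -
      ((t - t₀) ^ (k + 1) * u (t - t₀) * W t₀ + (t - t₀) ^ (k + 2) * v (t - t₀) * deriv W t₀)) ?_
    · filter_upwards [this] with t ht
      simp only [sub_self, zero_pow (Nat.succ_ne_zero _), zero_mul, add_zero, sub_zero] at ht
      linarith
    · filter_upwards [hh, hWw, self_mem_nhdsWithin] with t h1 h2 h3
      have d1 := ((hud (t - t₀)).comp_sub_const t t₀).mul_const (W t₀)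
      have d2 := ((hvd (t - t₀)).comp_sub_const t t₀).mul_const (deriv W t₀)
      have d3 := (hC t h3).fun_sub (d1.fun_add d2).hasDerivWithinAt
      convert! d3 using 1
      rw [h1, ← h2, hab t, hbb₁]
      ring
  filter_upwards [key hC₁ hWw₁ fun t => by simp only [a, b, add_sub_cancel]; field_simp; ring,
    key hC₂ hWw₂ fun t => by simp only [a, b, add_sub_cancel]; field_simp; ring] with t h1 h2
  ext
  · simpa using h1
  · simpa using h2

/-! ### Necessary conditions for a cusp and the cusp criterion -/

/-- Converse of `hasPlanarCusp_of_eventually_eq`. -/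
theorem HasPlanarCusp.exists_eventually_eq {i j : ℕ} (hi : i ≠ 0) (hj : j ≠ 0) {J : Set ℝ}
    {C : ℝ → ℝ × ℝ} {t₀ : ℝ} (h : HasPlanarCusp i j J C t₀) :
    ∃ (φ : ℝ → ℝ) (G : ℝ × ℝ → ℝ × ℝ), ContDiff ℝ ∞ φ ∧ φ t₀ = 0 ∧ deriv φ t₀ ≠ 0 ∧
      ContDiff ℝ ∞ G ∧ (∀ x, fderiv ℝ G 0 x = 0 → x = 0) ∧
      ∀ᶠ t in 𝓝[J] t₀, C t = G (φ t ^ i, φ t ^ j) := by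
  obtain ⟨e, Ψ, he₀, he0, hes, hes', hΨ₀, hΨ0, hΨs, hΨs', hC⟩ := h
  obtain ⟨φ, hφ, hφe⟩ := exists_contDiff_eventuallyEq (e.open_source.mem_nhds he₀) hes
  have ht₀ : (0 : ℝ × ℝ) ∈ Ψ.target := by
    have := Ψ.map_source hΨ₀
    rwa [hΨ0] at this
  have hΨt : Ψ.target ∈ 𝓝 (0 : ℝ × ℝ) := Ψ.open_target.mem_nhds ht₀
  obtain ⟨G, hG, hGΨ⟩ := exists_contDiff_eventuallyEq hΨt hΨs'
  have hφ0 : φ t₀ = 0 := by rw [hφe.self_of_nhds, he0]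
  refine ⟨φ, G, hφ, hφ0, fun hd => ?_, hG, fun x hx => ?_, ?_⟩
  · have ht : e.target ∈ 𝓝 (0 : ℝ) := e.open_target.mem_nhds (by
      have := e.map_source he₀; rwa [he0] at this)
    have hes0 : e.symm 0 = t₀ := by rw [← he0, e.left_inv he₀]
    have d1 : DifferentiableAt ℝ e.symm (e t₀) := by
      rw [he0]; exact (hes'.contDiffAt ht).differentiableAt (by simp)
    have d2 : HasDerivAt e 0 t₀ := by
      have := (hφ.differentiable (by simp) t₀).hasDerivAt
      rw [hd] at this
      exact this.congr_of_eventuallyEq hφe.symm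
    have d3 := d1.hasDerivAt.comp t₀ d2
    have d4 : (e.symm ∘ e) =ᶠ[𝓝 t₀] id := by
      filter_upwards [e.open_source.mem_nhds he₀] with t ht using e.left_inv ht
    have := (d3.congr_of_eventuallyEq d4.symm).unique (hasDerivAt_id t₀)
    simp at this
  · have hs0 : Ψ.symm 0 = C t₀ := by
      have := Ψ.left_inv hΨ₀
      rwa [hΨ0] at this
    have d1 : DifferentiableAt ℝ Ψ (Ψ.symm 0) := by
      rw [hs0]
      exact (hΨs.contDiffAt (Ψ.open_source.mem_nhds hΨ₀)).differentiableAt (by simp)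
    have d2 : HasFDerivAt Ψ.symm (fderiv ℝ G 0) 0 :=
      (hG.differentiable (by simp) 0).hasFDerivAt.congr_of_eventuallyEq hGΨ.symm
    have d3 := d1.hasFDerivAt.comp 0 d2
    have d4 : (Ψ ∘ Ψ.symm) =ᶠ[𝓝 0] id := by
      filter_upwards [hΨt] with t ht using Ψ.right_inv ht
    have := (d3.congr_of_eventuallyEq d4.symm).unique (hasFDerivAt_id 0)
    have := congrArg (fun L => L x) this
    simpa [hx] using this.symm
  · have hlim : Tendsto (fun t => (φ t ^ i, φ t ^ j)) (𝓝 t₀) (𝓝 0) := by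
      have : Continuous fun t => (φ t ^ i, φ t ^ j) := by
        have := hφ.continuous
        fun_prop
      have := this.tendsto t₀
      rw [hφ0, zero_pow hi, zero_pow hj] at this
      exact this
    filter_upwards [hC, (hlim.eventually hGΨ).filter_mono nhdsWithin_le_nhds,
      hφe.filter_mono nhdsWithin_le_nhds] with t h1 h2 h3
    rw [h2, h3, ← h1.2, Ψ.left_inv h1.1]

/-- The velocity of `g(φᵏ⁺¹, φᵏ⁺²)` is `φᵏ φ' E`, where `E` and its derivative at the cusp are read off
from the two partial derivatives of `g` at the origin. -/
theorem exists_hasDerivAt_comp_pow {g : ℝ × ℝ → ℝ} (hg : ContDiff ℝ ∞ g) {φ : ℝ → ℝ}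
    (hφ : ContDiff ℝ ∞ φ) {t₀ : ℝ} (hφ0 : φ t₀ = 0) {k : ℕ} (hk : k ≠ 0) :
    ∃ E : ℝ → ℝ, E t₀ = (k + 1) * fderiv ℝ g 0 (1, 0) ∧ Continuous E ∧
      HasDerivAt E ((k + 2) * deriv φ t₀ * fderiv ℝ g 0 (0, 1)) t₀ ∧
      ∀ t, HasDerivAt (fun t => g (φ t ^ (k + 1), φ t ^ (k + 2)))
        (φ t ^ k * deriv φ t * E t) t := by
  let p : ℝ → ℝ × ℝ := fun t => (φ t ^ (k + 1), φ t ^ (k + 2))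
  have hp : ContDiff ℝ ∞ p := by fun_prop
  have hp0 : p t₀ = 0 := by simp only [p, hφ0, zero_pow (Nat.succ_ne_zero _)]; rfl
  have hφd : ∀ t, HasDerivAt φ (deriv φ t) t := fun t =>
    (hφ.differentiable (by simp) t).hasDerivAt
  have hpd : ∀ t, HasDerivAt p
      (((k + 1 : ℕ) : ℝ) * φ t ^ k * deriv φ t, ((k + 2 : ℕ) : ℝ) * φ t ^ (k + 1) * deriv φ t) t :=
    fun t => ((hφd t).fun_pow (k + 1)).prodMk ((hφd t).fun_pow (k + 2))
  have hfd : ContDiff ℝ ∞ (fderiv ℝ g) := hg.fderiv_right (by simp)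
  have hX : ∀ y, ContDiff ℝ ∞ fun t => fderiv ℝ g (p t) y := fun y =>
    (hfd.comp hp).clm_apply contDiff_const
  have hpd0 : HasDerivAt p 0 t₀ := by
    have := hpd t₀
    rw [hφ0, zero_pow hk, zero_pow (Nat.succ_ne_zero _)] at this
    simp only [mul_zero, zero_mul] at this
    exact this
  have hXd : ∀ y, HasDerivAt (fun t => fderiv ℝ g (p t) y) 0 t₀ := fun y => by
    have h1 : HasFDerivAt (fderiv ℝ g) (fderiv ℝ (fderiv ℝ g) (p t₀)) (p t₀) :=
      (hfd.differentiable (by simp) _).hasFDerivAt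
    have := (h1.comp_hasDerivAt t₀ hpd0).clm_apply (hasDerivAt_const t₀ y)
    simpa using this
  refine ⟨fun t => (k + 1) * fderiv ℝ g (p t) (1, 0) + (k + 2) * φ t * fderiv ℝ g (p t) (0, 1),
    ?_, ?_, ?_, fun t => ?_⟩
  · simp [hp0, hφ0]
  · have h1 := (hX (1, 0)).continuous
    have h2 := (hX (0, 1)).continuous
    have h3 := hφ.continuous
    fun_prop
  · have := ((hXd (1, 0)).const_mul ((k : ℝ) + 1)).fun_add
      (((hφd t₀).const_mul ((k : ℝ) + 2)).fun_mul (hXd (0, 1)))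
    convert! this using 1
    simp [hp0]
  · have h1 : HasFDerivAt g (fderiv ℝ g (p t)) (p t) :=
      (hg.differentiable (by simp) _).hasFDerivAt
    have := h1.comp_hasDerivAt t (hpd t)
    convert! this using 1
    have hsplit : ∀ x y : ℝ, ((x, y) : ℝ × ℝ) = x • (1, 0) + y • (0, 1) := fun x y => by
      ext <;> simp
    rw [hsplit (_ * _), map_add, map_smul, map_smul]
    simp only [smul_eq_mul]
    push_cast
    ring

theorem exists_contDiff_eq_pow_mul_of_tendsto {l : Filter ℝ} [l.NeBot] (hl : l ≤ 𝓝[≠] 0) {k : ℕ}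
    {H : ℝ → ℝ} (hH : ContDiff ℝ ∞ H) {c : ℝ} (hc : Tendsto (fun s => H s / s ^ k) l (𝓝 c)) :
    ∃ h₁ : ℝ → ℝ, ContDiff ℝ ∞ h₁ ∧ h₁ 0 = c ∧ ∀ s, H s = s ^ k * h₁ s := by
  have hl0 : l ≤ 𝓝 0 := hl.trans nhdsWithin_le_nhds
  induction k generalizing H with
  | zero =>
    refine ⟨H, hH, ?_, by simp⟩
    simp only [pow_zero, div_one] at hc
    exact tendsto_nhds_unique ((hH.continuous.tendsto 0).mono_left hl0) hc
  | succ k ih =>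
    have hne : ∀ᶠ s in l, s ≠ 0 := hl self_mem_nhdsWithin
    have h0 : H 0 = 0 := by
      have h1 : Tendsto (fun s : ℝ => s ^ (k + 1)) l (𝓝 0) := by
        simpa using ((continuous_pow (k + 1)).tendsto (0 : ℝ)).mono_left hl0
      have h2 := hc.mul h1
      rw [mul_zero] at h2
      refine tendsto_nhds_unique ((hH.continuous.tendsto 0).mono_left hl0) (h2.congr' ?_)
      filter_upwards [hne] with s hs
      field_simp
    obtain ⟨g, hg, -, hHg⟩ := exists_contDiff_eq_mul hH h0
    obtain ⟨h₁, hh₁, hh₁0, hgh⟩ := ih hg (by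
      refine hc.congr' ?_
      filter_upwards [hne] with s hs
      rw [hHg, pow_succ]
      field_simp)
    exact ⟨h₁, hh₁, hh₁0, fun s => by rw [hHg, hgh]; ring⟩

/-- The function `h` on `J` vanishes at `t₀` to the order `k` exactly. The quotient by `(t - t₀)ᵏ` is
required to be a globally smooth function, also if `t₀` is an end point of `J`. -/
def VanishesToOrder (k : ℕ) (J : Set ℝ) (h : ℝ → ℝ) (t₀ : ℝ) : Prop :=
  ∃ h₁ : ℝ → ℝ, ContDiff ℝ ∞ h₁ ∧ h₁ 0 ≠ 0 ∧ ∀ᶠ t in 𝓝[J] t₀, h t = (t - t₀) ^ k * h₁ (t - t₀)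

section

variable {J : Set ℝ} {t₀ : ℝ}

theorem neBot_nhdsWithin_diff (hJ : J.OrdConnected) (hJ' : J.Nontrivial) (ht₀ : t₀ ∈ J) :
    (𝓝[J \ {t₀}] t₀).NeBot :=
  mem_closure_iff_nhdsWithin_neBot.1 <| by
    have := (uniqueDiffOn_of_ordConnected hJ hJ' t₀ ht₀).accPt
    rwa [accPt_principal_iff_nhdsWithin, ← mem_closure_iff_nhdsWithin_neBot] at this

theorem VanishesToOrder.of_tendsto (hJ : J.OrdConnected) (hJ' : J.Nontrivial) (ht₀ : t₀ ∈ J)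
    {h : ℝ → ℝ} (hh : ContDiffOn ℝ ∞ h J) {k : ℕ} {c : ℝ} (hc0 : c ≠ 0)
    (hc : Tendsto (fun t => h t / (t - t₀) ^ k) (𝓝[J \ {t₀}] t₀) (𝓝 c)) :
    VanishesToOrder k J h t₀ := by
  obtain ⟨H, hH, hHh⟩ := exists_contDiff_eventuallyEq_nhdsWithin hJ hJ' hh ht₀
  have := neBot_nhdsWithin_diff hJ hJ' ht₀
  have hle : Filter.map (fun t => t - t₀) (𝓝[J \ {t₀}] t₀) ≤ 𝓝[≠] 0 := by
    refine tendsto_nhdsWithin_iff.2 ⟨?_, ?_⟩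
    · have : Tendsto (fun t => t - t₀) (𝓝 t₀) (𝓝 (t₀ - t₀)) :=
        (continuous_sub_right t₀).tendsto t₀
      rw [sub_self] at this
      exact this.mono_left nhdsWithin_le_nhds
    · filter_upwards [self_mem_nhdsWithin] with t ht
      exact sub_ne_zero.2 ht.2
  obtain ⟨h₁, hh₁, hh₁0, hHh₁⟩ := exists_contDiff_eq_pow_mul_of_tendsto (k := k) (c := c) hle
    (H := fun s => H (t₀ + s)) (by fun_prop) (by
      rw [tendsto_map'_iff]
      refine hc.congr' ?_
      filter_upwards [hHh.filter_mono (nhdsWithin_mono t₀ sdiff_subset)] with t ht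
      simp [ht])
  refine ⟨h₁, hh₁, by rwa [hh₁0], ?_⟩
  filter_upwards [hHh] with t ht
  rw [← ht, ← hHh₁]
  simp

theorem vanishesToOrder_one_iff (hJ : J.OrdConnected) (hJ' : J.Nontrivial) (ht₀ : t₀ ∈ J)
    {h : ℝ → ℝ} (hh : ContDiffOn ℝ ∞ h J) {d : ℝ} (hd : HasDerivWithinAt h d J t₀) :
    VanishesToOrder 1 J h t₀ ↔ h t₀ = 0 ∧ d ≠ 0 := by
  constructor
  · rintro ⟨h₁, hh₁, hh₁0, hEq⟩
    have h0 := hEq.self_of_nhdsWithin ht₀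
    refine ⟨by simpa using h0, ?_⟩
    have d1 : HasDerivAt (fun t => (t - t₀) ^ 1 * h₁ (t - t₀)) (h₁ 0) t₀ := by
      have e1 := (hh₁.differentiable (by simp) (t₀ - t₀)).hasDerivAt.comp_sub_const t₀ t₀
      have := ((hasDerivAt_id' t₀).sub_const t₀).fun_mul e1
      simpa using this
    have d2 := hd.congr_of_eventuallyEq (EventuallyEq.symm hEq) h0.symm
    rwa [(uniqueDiffOn_of_ordConnected hJ hJ' t₀ ht₀).eq_deriv _ d2 d1.hasDerivWithinAt]
  · rintro ⟨h0, hd0⟩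
    refine VanishesToOrder.of_tendsto hJ hJ' ht₀ hh hd0 ?_
    have := hasDerivWithinAt_iff_tendsto_slope.1 hd
    refine this.congr fun t => ?_
    rw [slope_def_field, h0, sub_zero, pow_one]

theorem vanishesToOrder_two_iff (hJ : J.OrdConnected) (hJ' : J.Nontrivial) (ht₀ : t₀ ∈ J)
    {h h' : ℝ → ℝ} (hh : ContDiffOn ℝ ∞ h J) {d : ℝ} (hd : ∀ t ∈ J, HasDerivWithinAt h (h' t) J t)
    (hd' : HasDerivWithinAt h' d J t₀) :
    VanishesToOrder 2 J h t₀ ↔ h t₀ = 0 ∧ h' t₀ = 0 ∧ d ≠ 0 := by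
  have hud := uniqueDiffOn_of_ordConnected hJ hJ'
  have main : ∀ h₁ : ℝ → ℝ, ContDiff ℝ ∞ h₁ →
      (∀ᶠ t in 𝓝[J] t₀, h t = (t - t₀) ^ 2 * h₁ (t - t₀)) → h' t₀ = 0 ∧ d = 2 * h₁ 0 := by
    intro h₁ hh₁ hEq
    have e1 : ∀ t, HasDerivAt (fun t => h₁ (t - t₀)) (deriv h₁ (t - t₀)) t := fun t =>
      (hh₁.differentiable (by simp) (t - t₀)).hasDerivAt.comp_sub_const t t₀
    have e2 : ∀ t, HasDerivAt (fun t => (t - t₀) ^ 2 * h₁ (t - t₀))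
        (2 * (t - t₀) * h₁ (t - t₀) + (t - t₀) ^ 2 * deriv h₁ (t - t₀)) t := fun t => by
      have := (((hasDerivAt_id' t).sub_const t₀).fun_pow 2).fun_mul (e1 t)
      simpa using this
    have e3 : ∀ᶠ t in 𝓝[J] t₀, h' t =
        2 * (t - t₀) * h₁ (t - t₀) + (t - t₀) ^ 2 * deriv h₁ (t - t₀) := by
      filter_upwards [eventually_eventually_nhdsWithin.2 hEq, self_mem_nhdsWithin] with t ht htJ
      have d2 := (hd t htJ).congr_of_eventuallyEq (EventuallyEq.symm ht)
        (ht.self_of_nhdsWithin htJ).symm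
      exact (hud t htJ).eq_deriv _ d2 (e2 t).hasDerivWithinAt
    have e4 := e3.self_of_nhdsWithin ht₀
    refine ⟨by simpa using e4, ?_⟩
    have hd₁ : HasDerivAt (fun t => deriv h₁ (t - t₀)) (deriv (deriv h₁) (t₀ - t₀)) t₀ :=
      ((contDiff_infty_iff_deriv.1 hh₁).2.differentiable (by simp) _).hasDerivAt.comp_sub_const
        t₀ t₀
    have e5 : HasDerivAt (fun t => 2 * (t - t₀) * h₁ (t - t₀) + (t - t₀) ^ 2 * deriv h₁ (t - t₀))
        (2 * h₁ 0) t₀ := by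
      have := ((((hasDerivAt_id' t₀).sub_const t₀).const_mul 2).fun_mul (e1 t₀)).fun_add
        ((((hasDerivAt_id' t₀).sub_const t₀).fun_pow 2).fun_mul hd₁)
      simpa using this
    have d2 := hd'.congr_of_eventuallyEq (EventuallyEq.symm e3) e4.symm
    exact (hud t₀ ht₀).eq_deriv _ d2 e5.hasDerivWithinAt
  constructor
  · rintro ⟨h₁, hh₁, hh₁0, hEq⟩
    obtain ⟨m1, m2⟩ := main h₁ hh₁ hEq
    have h0 := hEq.self_of_nhdsWithin ht₀
    exact ⟨by simpa using h0, m1, by rw [m2]; simpa using hh₁0⟩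
  · rintro ⟨h0, h'0, hd0⟩
    obtain ⟨H, hH, hHh⟩ := exists_contDiff_eventuallyEq_nhdsWithin hJ hJ' hh ht₀
    have hH0 : H t₀ = h t₀ := hHh.self_of_nhdsWithin ht₀
    have hHd : HasDerivAt H 0 t₀ := by
      have e1 := (hH.differentiable (by simp) t₀).hasDerivAt
      have e2 := (hd t₀ ht₀).congr_of_eventuallyEq hHh hH0
      have := (hud t₀ ht₀).eq_deriv _ e2 e1.hasDerivWithinAt
      rw [← h'0, this]; exact e1
    obtain ⟨H₁, hH₁, hH₁0, hHH₁⟩ := exists_contDiff_eq_mul (f := fun s => H (t₀ + s))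
      (by fun_prop) (by simp [hH0, h0])
    have hH₁0' : H₁ 0 = 0 := by
      rw [hH₁0, deriv_comp_const_add, add_zero, hHd.deriv]
    obtain ⟨H₂, hH₂, -, hHH₂⟩ := exists_contDiff_eq_mul hH₁ hH₁0'
    have hEq : ∀ᶠ t in 𝓝[J] t₀, h t = (t - t₀) ^ 2 * H₂ (t - t₀) := by
      filter_upwards [hHh] with t ht
      have := hHH₁ (t - t₀)
      rw [hHH₂, add_sub_cancel, ht] at this
      rw [this]; ring
    refine ⟨H₂, hH₂, fun h2 => hd0 ?_, hEq⟩
    rw [(main H₂ hH₂ hEq).2, h2, mul_zero]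

/-- Necessity of the cusp criterion. At a cusp the velocity factors as `φᵏ φ' E`, so that
`h w = φᵏ φ' E`. Hence `w` and `E` are proportional, `h` vanishes to the same order as `φᵏ`, and
`w`, `w'` are independent because `E`, `E'` are. -/
theorem HasPlanarCusp.vanishesToOrder (hJ : J.OrdConnected) (hJ' : J.Nontrivial) (ht₀ : t₀ ∈ J)
    {C₁ C₂ h w₁ w₂ : ℝ → ℝ} {k : ℕ} (hk : k ≠ 0) (hh : ContDiffOn ℝ ∞ h J)
    (hC₁ : ∀ t ∈ J, HasDerivWithinAt C₁ (h t * w₁ t) J t)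
    (hC₂ : ∀ t ∈ J, HasDerivWithinAt C₂ (h t * w₂ t) J t)
    {w₁' w₂' : ℝ} (hw₁ : HasDerivWithinAt w₁ w₁' J t₀) (hw₂ : HasDerivWithinAt w₂ w₂' J t₀)
    (hw : w₁ t₀ ≠ 0 ∨ w₂ t₀ ≠ 0)
    (hcusp : HasPlanarCusp (k + 1) (k + 2) J (fun t => (C₁ t, C₂ t)) t₀) :
    VanishesToOrder k J h t₀ ∧ w₁ t₀ * w₂' - w₂ t₀ * w₁' ≠ 0 := by
  have hud := uniqueDiffOn_of_ordConnected hJ hJ'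
  have hneBot := neBot_nhdsWithin_diff hJ hJ' ht₀
  obtain ⟨φ, G, hφ, hφ0, hφ', hG, hGinj, hEq⟩ :=
    hcusp.exists_eventually_eq (Nat.succ_ne_zero _) (Nat.succ_ne_zero _)
  have hG₁ : ContDiff ℝ ∞ fun x => (G x).1 := by fun_prop
  have hG₂ : ContDiff ℝ ∞ fun x => (G x).2 := by fun_prop
  have hGd := hG.differentiable (by simp) 0
  have hfd₁ : ∀ y, fderiv ℝ (fun x => (G x).1) 0 y = (fderiv ℝ G 0 y).1 := fun y => by
    rw [fderiv.fst hGd]; rfl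
  have hfd₂ : ∀ y, fderiv ℝ (fun x => (G x).2) 0 y = (fderiv ℝ G 0 y).2 := fun y => by
    rw [fderiv.snd hGd]; rfl
  obtain ⟨E₁, hE₁0, hE₁c, hE₁d, hE₁⟩ := exists_hasDerivAt_comp_pow hG₁ hφ hφ0 hk
  obtain ⟨E₂, hE₂0, hE₂c, hE₂d, hE₂⟩ := exists_hasDerivAt_comp_pow hG₂ hφ hφ0 hk
  rw [hfd₁] at hE₁0 hE₁d
  rw [hfd₂] at hE₂0 hE₂d
  set E₁' := ((k : ℝ) + 2) * deriv φ t₀ * (fderiv ℝ G 0 (0, 1)).1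
  set E₂' := ((k : ℝ) + 2) * deriv φ t₀ * (fderiv ℝ G 0 (0, 1)).2
  have hdetE : E₁ t₀ * E₂' - E₂ t₀ * E₁' ≠ 0 := by
    have hdet : (fderiv ℝ G 0 (1, 0)).1 * (fderiv ℝ G 0 (0, 1)).2 -
        (fderiv ℝ G 0 (1, 0)).2 * (fderiv ℝ G 0 (0, 1)).1 ≠ 0 := by
      have hlin : ∀ x y : ℝ, fderiv ℝ G 0 (x, y) =
          x • fderiv ℝ G 0 (1, 0) + y • fderiv ℝ G 0 (0, 1) := fun x y => by
        rw [← map_smul, ← map_smul, ← map_add]; congr 1; ext <;> simp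
      intro h
      have h1 := hGinj ((fderiv ℝ G 0 (0, 1)).2, -(fderiv ℝ G 0 (1, 0)).2) (by
        rw [hlin]; ext <;> simp <;> linarith)
      have h2 := hGinj ((fderiv ℝ G 0 (0, 1)).1, -(fderiv ℝ G 0 (1, 0)).1) (by
        rw [hlin]; ext <;> simp <;> linarith)
      have h3 := hGinj (0, 1) (by
        ext
        · exact (Prod.mk_eq_zero.1 h2).1
        · exact (Prod.mk_eq_zero.1 h1).1)
      exact one_ne_zero (Prod.mk_eq_zero.1 h3).2
    have : E₁ t₀ * E₂' - E₂ t₀ * E₁' = (k + 1) * (k + 2) * deriv φ t₀ *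
        ((fderiv ℝ G 0 (1, 0)).1 * (fderiv ℝ G 0 (0, 1)).2 -
        (fderiv ℝ G 0 (1, 0)).2 * (fderiv ℝ G 0 (0, 1)).1) := by
      rw [hE₁0, hE₂0]; simp only [E₁', E₂']; ring
    rw [this]
    positivity
  -- comparison of the two factorizations of the velocity
  have hcomp : ∀ {C w E : ℝ → ℝ} {g : ℝ × ℝ → ℝ},
      (∀ t ∈ J, HasDerivWithinAt C (h t * w t) J t) →
      (∀ t, HasDerivAt (fun t => g (φ t ^ (k + 1), φ t ^ (k + 2))) (φ t ^ k * deriv φ t * E t) t) →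
      (∀ᶠ t in 𝓝[J] t₀, C t = g (φ t ^ (k + 1), φ t ^ (k + 2))) →
      ∀ᶠ t in 𝓝[J] t₀, h t * w t = φ t ^ k * deriv φ t * E t := by
    intro C w E g hC hE hEq
    filter_upwards [eventually_eventually_nhdsWithin.2 hEq, self_mem_nhdsWithin] with t ht htJ
    have d2 := (hC t htJ).congr_of_eventuallyEq (EventuallyEq.symm ht)
      (ht.self_of_nhdsWithin htJ).symm
    exact (hud t htJ).eq_deriv _ d2 (hE t).hasDerivWithinAt
  have hv₁ := hcomp (g := fun x => (G x).1) hC₁ hE₁ (hEq.mono fun t ht => congrArg Prod.fst ht)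
  have hv₂ := hcomp (g := fun x => (G x).2) hC₂ hE₂ (hEq.mono fun t ht => congrArg Prod.snd ht)
  have hle : 𝓝[J \ {t₀}] t₀ ≤ 𝓝[J] t₀ := nhdsWithin_mono _ sdiff_subset
  have hle' : 𝓝[J \ {t₀}] t₀ ≤ 𝓝[≠] t₀ := nhdsWithin_mono _ fun t ht => ht.2
  have hφne : ∀ᶠ t in 𝓝[J \ {t₀}] t₀, φ t ^ k * deriv φ t ≠ 0 := by
    have h1 := (hφ.differentiable (by simp) t₀).hasDerivAt.eventually_ne (c := 0) hφ'
    have h2 : ∀ᶠ t in 𝓝 t₀, deriv φ t ≠ 0 :=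
      (hφ.continuous_deriv (by simp)).continuousAt.eventually_ne hφ'
    filter_upwards [hle' h1, (h2.filter_mono nhdsWithin_le_nhds)] with t h1 h2
    exact mul_ne_zero (pow_ne_zero k h1) h2
  have hdet0 : ∀ᶠ t in 𝓝[J \ {t₀}] t₀, w₁ t * E₂ t - w₂ t * E₁ t = 0 := by
    filter_upwards [hle hv₁, hle hv₂, hφne] with t h1 h2 h3
    refine (mul_eq_zero.1 (?_ : (φ t ^ k * deriv φ t) * _ = 0)).resolve_left h3
    linear_combination w₂ t * h1 - w₁ t * h2
  have hdw : HasDerivWithinAt (fun t => w₁ t * E₂ t - w₂ t * E₁ t)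
      (w₁' * E₂ t₀ + w₁ t₀ * E₂' - (w₂' * E₁ t₀ + w₂ t₀ * E₁')) J t₀ :=
    (hw₁.fun_mul hE₂d.hasDerivWithinAt).fun_sub (hw₂.fun_mul hE₁d.hasDerivWithinAt)
  have hdet00 : w₁ t₀ * E₂ t₀ - w₂ t₀ * E₁ t₀ = 0 := by
    have h1 : Tendsto (fun t => w₁ t * E₂ t - w₂ t * E₁ t) (𝓝[J \ {t₀}] t₀)
        (𝓝 (w₁ t₀ * E₂ t₀ - w₂ t₀ * E₁ t₀)) := hdw.continuousWithinAt.tendsto.mono_left hle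
    exact tendsto_nhds_unique h1 (tendsto_const_nhds.congr' (hdet0.mono fun t ht => ht.symm))
  have hder : w₁' * E₂ t₀ + w₁ t₀ * E₂' - (w₂' * E₁ t₀ + w₂ t₀ * E₁') = 0 := by
    have h1 : ∀ᶠ t in 𝓝[J] t₀, (0 : ℝ) = w₁ t * E₂ t - w₂ t * E₁ t := by
      have := eventually_nhdsWithin_iff.1 hdet0
      refine eventually_nhdsWithin_iff.2 (this.mono fun t ht htJ => ?_)
      by_cases h : t = t₀
      · rw [h, hdet00]
      · rw [ht ⟨htJ, h⟩]
    have h2 := hdw.congr_of_eventuallyEq (f₁ := fun _ => 0) h1 hdet00.symm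
    exact (hud t₀ ht₀).eq_deriv _ h2 (hasDerivWithinAt_const _ _ _)
  refine ⟨?_, fun hcon => hdetE ?_⟩
  · have hord : ∀ {w E : ℝ → ℝ}, ContinuousWithinAt w J t₀ → Continuous E → w t₀ ≠ 0 →
        E t₀ ≠ 0 → (∀ᶠ t in 𝓝[J] t₀, h t * w t = φ t ^ k * deriv φ t * E t) →
        VanishesToOrder k J h t₀ := by
      intro w E hwc hEc hw0 hE0 hv
      have hs : Tendsto (fun t => φ t / (t - t₀)) (𝓝[J \ {t₀}] t₀) (𝓝 (deriv φ t₀)) := by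
        have := hasDerivAt_iff_tendsto_slope.1 (hφ.differentiable (by simp) t₀).hasDerivAt
        refine (this.mono_left hle').congr fun t => ?_
        rw [slope_def_field, hφ0, sub_zero]
      have hE' : Tendsto E (𝓝[J \ {t₀}] t₀) (𝓝 (E t₀)) :=
        (hEc.tendsto t₀).mono_left nhdsWithin_le_nhds
      have hφ'' : Tendsto (deriv φ) (𝓝[J \ {t₀}] t₀) (𝓝 (deriv φ t₀)) :=
        ((hφ.continuous_deriv (by simp)).tendsto t₀).mono_left nhdsWithin_le_nhds
      have hw' : Tendsto w (𝓝[J \ {t₀}] t₀) (𝓝 (w t₀)) := hwc.tendsto.mono_left hle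
      have hlim := (((hs.pow k).mul hφ'').mul hE').div hw' hw0
      refine VanishesToOrder.of_tendsto hJ hJ' ht₀ hh ?_ (hlim.congr' ?_)
      · exact div_ne_zero (mul_ne_zero (mul_ne_zero (pow_ne_zero _ hφ') hφ') hE0) hw0
      · filter_upwards [hle hv, hw'.eventually_ne hw0, self_mem_nhdsWithin] with t h1 h2 h3
        have h4 : t - t₀ ≠ 0 := sub_ne_zero.2 h3.2
        simp only [Pi.div_apply, div_pow]
        field_simp
        linarith
    rcases hw with hw | hw
    · refine hord hw₁.continuousWithinAt hE₁c hw (fun h0 => hdetE ?_) hv₁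
      have : E₂ t₀ = 0 := by
        rw [h0, mul_zero, sub_zero] at hdet00
        exact (mul_eq_zero.1 hdet00).resolve_left hw
      rw [h0, this]; ring
    · refine hord hw₂.continuousWithinAt hE₂c hw (fun h0 => hdetE ?_) hv₂
      have : E₁ t₀ = 0 := by
        rw [h0, mul_zero, zero_sub, neg_eq_zero] at hdet00
        exact (mul_eq_zero.1 hdet00).resolve_left hw
      rw [h0, this]; ring
  · rcases hw with hw | hw
    · refine (mul_eq_zero.1 (?_ : (w₁ t₀ * w₁ t₀) * _ = 0)).resolve_left (mul_ne_zero hw hw)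
      linear_combination (w₁ t₀ * E₁ t₀) * hder + E₁ t₀ * E₁ t₀ * hcon +
        (-(E₁ t₀) * w₁' - w₁ t₀ * E₁') * hdet00
    · refine (mul_eq_zero.1 (?_ : (w₂ t₀ * w₂ t₀) * _ = 0)).resolve_left (mul_ne_zero hw hw)
      linear_combination (w₂ t₀ * E₂ t₀) * hder + E₂ t₀ * E₂ t₀ * hcon +
        (-(E₂ t₀) * w₂' - w₂ t₀ * E₂') * hdet00

/-- Cusp criterion for a plane curve with velocity `h w`: a `(k + 1, k + 2)`-cusp means that `h`
vanishes to order `k` and that `w`, `w'` are independent, provided that the curves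
`(sᵏ⁺¹ u(s), sᵏ⁺² v(s))` have the normal form. -/
theorem hasPlanarCusp_succ_iff (hJ : J.OrdConnected) (hJ' : J.Nontrivial) (ht₀ : t₀ ∈ J)
    {C₁ C₂ h w₁ w₂ : ℝ → ℝ} {k : ℕ} (hk : k ≠ 0)
    (hnf : ∀ {u v : ℝ → ℝ}, ContDiff ℝ ∞ u → ContDiff ℝ ∞ v → u 0 ≠ 0 → v 0 ≠ 0 →
      HasNormalForm (k + 1) (k + 2) u v)
    (hh : ContDiffOn ℝ ∞ h J) (hw₁ : ContDiffOn ℝ ∞ w₁ J) (hw₂ : ContDiffOn ℝ ∞ w₂ J)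
    (hC₁ : ∀ t ∈ J, HasDerivWithinAt C₁ (h t * w₁ t) J t)
    (hC₂ : ∀ t ∈ J, HasDerivWithinAt C₂ (h t * w₂ t) J t)
    {w₁' w₂' : ℝ} (hw₁' : HasDerivWithinAt w₁ w₁' J t₀) (hw₂' : HasDerivWithinAt w₂ w₂' J t₀)
    (hw : w₁ t₀ ≠ 0 ∨ w₂ t₀ ≠ 0) :
    HasPlanarCusp (k + 1) (k + 2) J (fun t => (C₁ t, C₂ t)) t₀ ↔
      VanishesToOrder k J h t₀ ∧ w₁ t₀ * w₂' - w₂ t₀ * w₁' ≠ 0 := by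
  refine ⟨fun hc => hc.vanishesToOrder hJ hJ' ht₀ hk hh hC₁ hC₂ hw₁' hw₂' hw, ?_⟩
  rintro ⟨⟨h₁, hh₁, hh₁0, hEq⟩, hdet⟩
  have hud := uniqueDiffOn_of_ordConnected hJ hJ' t₀ ht₀
  rw [← hw₁'.derivWithin hud, ← hw₂'.derivWithin hud] at hdet
  obtain ⟨u, v, hu, hv, hu0, hv0, hC⟩ :=
    exists_adapted_coordinates hJ hJ' ht₀ hC₁ hC₂ hw₁ hw₂ hh₁ hh₁0 hEq hdet
  exact hasPlanarCusp_of_hasNormalForm (Nat.succ_ne_zero _) (Nat.succ_ne_zero _)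
    (hnf hu hv hu0 hv0) ht₀ hdet hC

end

end SmoothGerm

namespace Horocyclic

/-! ### Lorentz-Minkowski algebra and pseudo-orthonormal frames -/

theorem mink_comm (x y : Fin 3 → ℝ) : mink x y = mink y x := by
  simp only [mink]; ring

theorem mink_smul_left (c : ℝ) (x y : Fin 3 → ℝ) : mink (c • x) y = c * mink x y := by
  simp only [mink, Pi.smul_apply, smul_eq_mul]; ring

theorem mink_wedge_left (x y : Fin 3 → ℝ) : mink x (wedge x y) = 0 := by
  simp [mink, wedge]; ring

theorem mink_wedge_right (x y : Fin 3 → ℝ) : mink y (wedge x y) = 0 := by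
  simp [mink, wedge]; ring

theorem wedge_wedge (x y z : Fin 3 → ℝ) :
    wedge x (wedge y z) = -mink x z • y + mink x y • z := by
  ext i; fin_cases i <;> simp [mink, wedge] <;> ring

theorem wedge_anticomm (x y : Fin 3 → ℝ) : wedge x y = -wedge y x := by
  ext i; fin_cases i <;> simp [wedge] <;> ring

/-- The component of `x` along `y ∧ z`, up to a factor, in terms of `x`, `y`, `z` and their Gram
matrix. -/
theorem mink_wedge_smul_wedge (x y z : Fin 3 → ℝ) :
    mink x (wedge y z) • wedge y z = -(mink y y * mink z z - mink y z ^ 2) • x +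
      (mink x y * mink z z - mink x z * mink y z) • y +
      (mink x z * mink y y - mink x y * mink y z) • z := by
  ext i; fin_cases i <;> simp [mink, wedge] <;> ring

/-- The vectors `a`, `b` and `a ∧ b` form a pseudo-orthonormal frame with `a` timelike. -/
structure IsFrame (a b : Fin 3 → ℝ) : Prop where
  left : mink a a = -1
  right : mink b b = 1
  orthogonal : mink a b = 0

namespace IsFrame

variable {a b : Fin 3 → ℝ}

theorem wedge_right (h : IsFrame a b) : wedge b (wedge a b) = -a := by
  rw [wedge_wedge, h.right, mink_comm, h.orthogonal]; simp

theorem wedge_left (h : IsFrame a b) : wedge (wedge a b) a = b := by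
  rw [wedge_anticomm, wedge_wedge, h.left, h.orthogonal]; simp

theorem expand (h : IsFrame a b) (x : Fin 3 → ℝ) :
    x = -mink x a • a + mink x b • b + mink x (wedge a b) • wedge a b := by
  rw [mink_wedge_smul_wedge, h.left, h.right, h.orthogonal]
  ext i; simp; ring

theorem mink_wedge_wedge (h : IsFrame a b) : mink (wedge a b) (wedge a b) = 1 := by
  have : mink (wedge a b) (wedge a b) = mink a b ^ 2 - mink a a * mink b b := by
    simp [mink, wedge]; ring
  rw [this, h.left, h.right, h.orthogonal]; ring

theorem mink_comb (h : IsFrame a b) (x y z x' y' z' : ℝ) :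
    mink (x • a + y • b + z • wedge a b) (x' • a + y' • b + z' • wedge a b) =
      -(x * x') + y * y' + z * z' := by
  have h1 : mink (x • a + y • b + z • wedge a b) (x' • a + y' • b + z' • wedge a b) =
      x * x' * mink a a + y * y' * mink b b + z * z' * mink (wedge a b) (wedge a b) +
      (x * y' + y * x') * mink a b + (x * z' + z * x') * mink a (wedge a b) +
      (y * z' + z * y') * mink b (wedge a b) := by
    simp only [mink, Pi.add_apply, Pi.smul_apply, smul_eq_mul]; ring
  rw [h1, h.left, h.right, h.orthogonal, h.mink_wedge_wedge, mink_wedge_left, mink_wedge_right]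
  ring

theorem wedge_comb (h : IsFrame a b) (x y z x' y' z' : ℝ) :
    wedge (x • a + y • b + z • wedge a b) (x' • a + y' • b + z' • wedge a b) =
      (z * y' - y * z') • a + (z * x' - x * z') • b + (x * y' - y * x') • wedge a b := by
  have h1 : ∀ c, wedge (x • a + y • b + z • c) (x' • a + y' • b + z' • c) =
      (y * z' - z * y') • wedge b c + (z * x' - x * z') • wedge c a +
        (x * y' - y * x') • wedge a b := fun c => by
    ext i; fin_cases i <;> simp [wedge] <;> ring
  rw [h1, h.wedge_right, h.wedge_left]
  ext i; simp; ring

/-- The upper sheet is recognised by the sign of the product with `a`, by the Cauchy-Schwarz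
inequality for the last two coordinates. -/
theorem comb_mem_hyperbolicPlane (h : IsFrame a b) (ha : 0 < a 0) {x y z : ℝ} (hx : 0 < x)
    (hxyz : -(x * x) + y * y + z * z = -1) :
    x • a + y • b + z • wedge a b ∈ hyperbolicPlane := by
  set p := x • a + y • b + z • wedge a b with hp
  have hpp : mink p p = -1 := by rw [hp, h.mink_comb, hxyz]
  have hpa : mink p a = -x := by
    have := h.mink_comb x y z 1 0 0
    simpa [hp] using this
  refine ⟨hpp, ?_⟩
  have haa := h.left
  by_contra hneg
  push Not at hneg
  simp only [mink] at hpp hpa haa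
  -- the Cauchy-Schwarz inequality for the last two coordinates
  have hcs : (p 1 * a 1 + p 2 * a 2) ^ 2 ≤ (p 1 ^ 2 + p 2 ^ 2) * (a 1 ^ 2 + a 2 ^ 2) := by
    nlinarith [sq_nonneg (p 1 * a 2 - p 2 * a 1)]
  have h1 : p 1 ^ 2 + p 2 ^ 2 = p 0 ^ 2 - 1 := by linarith
  have h2 : a 1 ^ 2 + a 2 ^ 2 = a 0 ^ 2 - 1 := by linarith
  rw [h1, h2] at hcs
  have h3 : p 1 * a 1 + p 2 * a 2 < p 0 * a 0 := by linarith
  have h4 : p 0 * a 0 ≤ 0 := mul_nonpos_of_nonpos_of_nonneg hneg ha.le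
  have h5 : (p 0 * a 0) ^ 2 < (p 1 * a 1 + p 2 * a 2) ^ 2 := by nlinarith
  have h6 : 1 ≤ p 0 ^ 2 := by nlinarith [sq_nonneg (p 1), sq_nonneg (p 2)]
  have h7 : 1 ≤ a 0 ^ 2 := by nlinarith [sq_nonneg (a 1), sq_nonneg (a 2)]
  nlinarith

end IsFrame

/-! ### Frenet type formulas of a spacelike Legendre curve -/

section

variable {J : Set ℝ} {t : ℝ} {x y x' y' : ℝ → Fin 3 → ℝ}

theorem hasDerivWithinAt_mink {x y : ℝ → Fin 3 → ℝ} {x' y' : Fin 3 → ℝ}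
    (hx : HasDerivWithinAt x x' J t) (hy : HasDerivWithinAt y y' J t) :
    HasDerivWithinAt (fun t => mink (x t) (y t)) (mink x' (y t) + mink (x t) y') J t := by
  have hx := hasDerivWithinAt_pi.1 hx
  have hy := hasDerivWithinAt_pi.1 hy
  have := (((hx 0).fun_mul (hy 0)).fun_neg.fun_add ((hx 1).fun_mul (hy 1))).fun_add
    ((hx 2).fun_mul (hy 2))
  convert! this using 1
  simp only [mink]; ring

theorem hasDerivWithinAt_wedge {x y : ℝ → Fin 3 → ℝ} {x' y' : Fin 3 → ℝ}
    (hx : HasDerivWithinAt x x' J t) (hy : HasDerivWithinAt y y' J t) :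
    HasDerivWithinAt (fun t => wedge (x t) (y t)) (wedge x' (y t) + wedge (x t) y') J t := by
  have hx := hasDerivWithinAt_pi.1 hx
  have hy := hasDerivWithinAt_pi.1 hy
  refine hasDerivWithinAt_pi.2 fun i => ?_
  fin_cases i
  · have := (((hx 1).fun_mul (hy 2)).fun_sub ((hx 2).fun_mul (hy 1))).fun_neg
    convert! this using 1
    simp [wedge]; ring
  · have := (((hx 0).fun_mul (hy 2)).fun_sub ((hx 2).fun_mul (hy 0))).fun_neg
    convert! this using 1
    simp [wedge]; ring
  · have := ((hx 0).fun_mul (hy 1)).fun_sub ((hx 1).fun_mul (hy 0))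
    convert! this using 1
    simp [wedge]; ring

theorem contDiffOn_mink (hx : ContDiffOn ℝ ∞ x J) (hy : ContDiffOn ℝ ∞ y J) :
    ContDiffOn ℝ ∞ (fun t => mink (x t) (y t)) J := by
  have hx := contDiffOn_pi.1 hx
  have hy := contDiffOn_pi.1 hy
  exact (((hx 0).mul (hy 0)).neg.add ((hx 1).mul (hy 1))).add ((hx 2).mul (hy 2))

theorem contDiffOn_wedge (hx : ContDiffOn ℝ ∞ x J) (hy : ContDiffOn ℝ ∞ y J) :
    ContDiffOn ℝ ∞ (fun t => wedge (x t) (y t)) J := by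
  have hx := contDiffOn_pi.1 hx
  have hy := contDiffOn_pi.1 hy
  refine contDiffOn_pi.2 fun i => ?_
  fin_cases i
  · exact (((hx 1).mul (hy 2)).sub ((hx 2).mul (hy 1))).neg
  · exact (((hx 0).mul (hy 2)).sub ((hx 2).mul (hy 0))).neg
  · exact ((hx 0).mul (hy 1)).sub ((hx 1).mul (hy 0))

end

namespace IsSpacelikeLegendreCurve

variable {I J : Set ℝ} {γ ν : ℝ → Fin 3 → ℝ} {t : ℝ}

theorem isFrame (h : IsSpacelikeLegendreCurve I γ ν) (ht : t ∈ I) : IsFrame (γ t) (ν t) :=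
  ⟨(h.base_mem t ht).1, h.normal_mem t ht, h.orthogonal t ht⟩

theorem hasDerivWithinAt_base' (h : IsSpacelikeLegendreCurve I γ ν) (ht : t ∈ I) :
    HasDerivWithinAt γ (derivWithin γ I t) I t :=
  ((h.smooth_base.differentiableOn (by simp)) t ht).hasDerivWithinAt

theorem hasDerivWithinAt_normal' (h : IsSpacelikeLegendreCurve I γ ν) (ht : t ∈ I) :
    HasDerivWithinAt ν (derivWithin ν I t) I t :=
  ((h.smooth_normal.differentiableOn (by simp)) t ht).hasDerivWithinAt

theorem hasDerivWithinAt_base (h : IsSpacelikeLegendreCurve I γ ν) (hI : UniqueDiffOn ℝ I)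
    (ht : t ∈ I) : HasDerivWithinAt γ (curvM I γ ν t • frameMu γ ν t) I t := by
  have hd := h.hasDerivWithinAt_base' ht
  have h1 : mink (derivWithin γ I t) (γ t) = 0 := by
    have e1 := hasDerivWithinAt_mink hd hd
    have e2 : HasDerivWithinAt (fun t => mink (γ t) (γ t)) 0 I t :=
      (hasDerivWithinAt_const t I (-1)).congr (fun s hs => (h.isFrame hs).left) (h.isFrame ht).left
    have := (hI t ht).eq_deriv _ e1 e2
    rw [mink_comm (γ t)] at this
    linarith
  have h2 := (h.isFrame ht).expand (derivWithin γ I t)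
  rw [h1, h.legendre t ht] at h2
  have h3 : derivWithin γ I t = curvM I γ ν t • frameMu γ ν t := by
    rw [h2]
    simp [curvM, frameMu]
  rwa [← h3]

theorem hasDerivWithinAt_normal (h : IsSpacelikeLegendreCurve I γ ν) (hI : UniqueDiffOn ℝ I)
    (ht : t ∈ I) : HasDerivWithinAt ν (curvN I γ ν t • frameMu γ ν t) I t := by
  have hd := h.hasDerivWithinAt_normal' ht
  have h1 : mink (derivWithin ν I t) (ν t) = 0 := by
    have e1 := hasDerivWithinAt_mink hd hd
    have e2 : HasDerivWithinAt (fun t => mink (ν t) (ν t)) 0 I t :=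
      (hasDerivWithinAt_const t I 1).congr (fun s hs => (h.isFrame hs).right) (h.isFrame ht).right
    have := (hI t ht).eq_deriv _ e1 e2
    rw [mink_comm (ν t)] at this
    linarith
  have h0 : mink (derivWithin ν I t) (γ t) = 0 := by
    have e1 := hasDerivWithinAt_mink (h.hasDerivWithinAt_base' ht) hd
    have e2 : HasDerivWithinAt (fun t => mink (γ t) (ν t)) 0 I t :=
      (hasDerivWithinAt_const t I 0).congr (fun s hs => (h.isFrame hs).orthogonal)
        (h.isFrame ht).orthogonal
    have := (hI t ht).eq_deriv _ e1 e2
    rw [h.legendre t ht, mink_comm (γ t)] at this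
    linarith
  have h2 := (h.isFrame ht).expand (derivWithin ν I t)
  rw [h1, h0] at h2
  have h3 : derivWithin ν I t = curvN I γ ν t • frameMu γ ν t := by
    rw [h2]
    simp [curvN, frameMu]
  rwa [← h3]

theorem hasDerivWithinAt_frameMu (h : IsSpacelikeLegendreCurve I γ ν) (hI : UniqueDiffOn ℝ I)
    (ht : t ∈ I) : HasDerivWithinAt (frameMu γ ν)
      (curvM I γ ν t • γ t - curvN I γ ν t • ν t) I t := by
  have := hasDerivWithinAt_wedge (h.hasDerivWithinAt_base hI ht) (h.hasDerivWithinAt_normal hI ht)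
  convert! this using 1
  have hf := h.isFrame ht
  have e1 := hf.wedge_comb 0 0 (curvM I γ ν t) 0 1 0
  have e2 := hf.wedge_comb 1 0 0 0 0 (curvN I γ ν t)
  simp only [zero_smul, zero_add, one_smul, add_zero, mul_zero, mul_one, zero_mul, sub_zero,
    one_mul, zero_sub] at e1 e2
  rw [frameMu, e1, e2, neg_smul, sub_eq_add_neg]

theorem contDiffOn_frameMu (h : IsSpacelikeLegendreCurve I γ ν) :
    ContDiffOn ℝ ∞ (frameMu γ ν) I :=
  contDiffOn_wedge h.smooth_base h.smooth_normal

theorem contDiffOn_curvM (h : IsSpacelikeLegendreCurve I γ ν) (hI : UniqueDiffOn ℝ I) :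
    ContDiffOn ℝ ∞ (curvM I γ ν) I :=
  contDiffOn_mink (h.smooth_base.derivWithin hI (by simp)) h.contDiffOn_frameMu

theorem contDiffOn_curvN (h : IsSpacelikeLegendreCurve I γ ν) (hI : UniqueDiffOn ℝ I) :
    ContDiffOn ℝ ∞ (curvN I γ ν) I :=
  contDiffOn_mink (h.smooth_normal.derivWithin hI (by simp)) h.contDiffOn_frameMu

/-- Derivative of a curve that is given by its coefficients in the moving frame. -/
theorem hasDerivWithinAt_comb (h : IsSpacelikeLegendreCurve I γ ν) (hI : UniqueDiffOn ℝ I)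
    (hJI : J ⊆ I) (ht : t ∈ J) {a b c : ℝ → ℝ} {a' b' c' : ℝ} (ha : HasDerivWithinAt a a' J t)
    (hb : HasDerivWithinAt b b' J t) (hc : HasDerivWithinAt c c' J t) :
    HasDerivWithinAt (fun t => a t • γ t + b t • ν t + c t • frameMu γ ν t)
      ((a' + c t * curvM I γ ν t) • γ t + (b' - c t * curvN I γ ν t) • ν t +
        (c' + a t * curvM I γ ν t + b t * curvN I γ ν t) • frameMu γ ν t) J t := by
  have hγ := (h.hasDerivWithinAt_base hI (hJI ht)).mono hJI
  have hν := (h.hasDerivWithinAt_normal hI (hJI ht)).mono hJI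
  have hμ := (h.hasDerivWithinAt_frameMu hI (hJI ht)).mono hJI
  have := ((ha.fun_smul hγ).fun_add (hb.fun_smul hν)).fun_add (hc.fun_smul hμ)
  convert! this using 1
  module

theorem contDiffOn_comb (h : IsSpacelikeLegendreCurve I γ ν) (hJI : J ⊆ I) {a b c : ℝ → ℝ}
    (ha : ContDiffOn ℝ ∞ a J) (hb : ContDiffOn ℝ ∞ b J) (hc : ContDiffOn ℝ ∞ c J) :
    ContDiffOn ℝ ∞ (fun t => a t • γ t + b t • ν t + c t • frameMu γ ν t) J :=
  ((ha.smul (h.smooth_base.mono hJI)).add (hb.smul (h.smooth_normal.mono hJI))).add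
    (hc.smul (h.contDiffOn_frameMu.mono hJI))

open SmoothGerm

/-- Cusp criterion for a spacelike Legendre curve with curvature `(m, n)`: as `γ' = m μ` and
`μ' = m γ - n ν`, it has a `(k + 1, k + 2)`-cusp where `m` vanishes to order `k` and `n` does not
vanish, provided that the curves `(sᵏ⁺¹ u(s), sᵏ⁺² v(s))` have the normal form. -/
theorem hasCusp_succ_iff (h : IsSpacelikeLegendreCurve J γ ν) (hJ : J.OrdConnected)
    (hJ' : J.Nontrivial) (ht : t ∈ J) {k : ℕ} (hk : k ≠ 0)
    (hnf : ∀ {u v : ℝ → ℝ}, ContDiff ℝ ∞ u → ContDiff ℝ ∞ v → u 0 ≠ 0 → v 0 ≠ 0 →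
      HasNormalForm (k + 1) (k + 2) u v) :
    HasCusp (k + 1) (k + 2) J γ t ↔
      VanishesToOrder k J (curvM J γ ν) t ∧ curvN J γ ν t ≠ 0 := by
  have hud := uniqueDiffOn_of_ordConnected hJ hJ'
  have hγ := fun s (hs : s ∈ J) => hasDerivWithinAt_pi.1 (h.hasDerivWithinAt_base hud hs)
  have hμ := hasDerivWithinAt_pi.1 (h.hasDerivWithinAt_frameMu hud ht)
  have hμs := contDiffOn_pi.1 h.contDiffOn_frameMu
  -- the determinant of `ν` and `μ` in the chart is the first coordinate of `γ`
  have hpos : 0 < ν t 1 * frameMu γ ν t 2 - ν t 2 * frameMu γ ν t 1 := by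
    have e1 := congrFun (h.isFrame ht).wedge_right 0
    have e2 : wedge (ν t) (wedge (γ t) (ν t)) 0 =
        -(ν t 1 * frameMu γ ν t 2 - ν t 2 * frameMu γ ν t 1) := rfl
    rw [e2, Pi.neg_apply, neg_inj] at e1
    rw [e1]
    exact (h.base_mem t ht).2
  have hne : frameMu γ ν t 1 ≠ 0 ∨ frameMu γ ν t 2 ≠ 0 := by
    by_contra! hcon
    rw [hcon.1, hcon.2] at hpos
    simp at hpos
  have key := hasPlanarCusp_succ_iff hJ hJ' ht hk hnf (h.contDiffOn_curvM hud) (hμs 1) (hμs 2)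
    (fun s hs => hγ s hs 1) (fun s hs => hγ s hs 2) (hμ 1) (hμ 2) hne
  refine key.trans (and_congr_right fun hv => ?_)
  have hm : curvM J γ ν t = 0 := by
    obtain ⟨h₁, -, -, hEq⟩ := hv
    rw [hEq.self_of_nhdsWithin ht, sub_self, zero_pow hk, zero_mul]
  rw [hm]
  have : frameMu γ ν t 1 * ((0 : ℝ) • γ t - curvN J γ ν t • ν t) 2 -
      frameMu γ ν t 2 * ((0 : ℝ) • γ t - curvN J γ ν t • ν t) 1 =
      curvN J γ ν t * (ν t 1 * frameMu γ ν t 2 - ν t 2 * frameMu γ ν t 1) := by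
    simp; ring
  rw [this]
  exact ⟨fun hh => left_ne_zero_of_mul hh, fun hh => mul_ne_zero hh hpos.ne'⟩

end IsSpacelikeLegendreCurve

/-! ### Horocyclic parallels -/

open SmoothGerm

variable {I J : Set ℝ} {γ ν : ℝ → Fin 3 → ℝ} {ε : ℝ} {f l : ℝ → ℝ} {t : ℝ}

theorem normalHorocyclePoint_eq (ε : ℝ) (γ ν : ℝ → Fin 3 → ℝ) (s : ℝ → ℝ) (t : ℝ) :
    normalHorocyclePoint ε γ ν s t =
      (1 + s t ^ 2 / 2) • γ t + s t • ν t + (ε * s t ^ 2 / 2) • frameMu γ ν t := by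
  simp only [normalHorocyclePoint]
  module

theorem parallelNormal_eq (ε : ℝ) (γ ν : ℝ → Fin 3 → ℝ) (l : ℝ → ℝ) (t : ℝ) :
    parallelNormal ε γ ν l t = l t • γ t + (1 : ℝ) • ν t + (ε * l t) • frameMu γ ν t := by
  rw [parallelNormal, one_smul]

/-- A point of the normal horocycle determines its parameter, the coefficient of `ν`. -/
theorem IsFrame.normalHorocyclePoint_injective (h : IsFrame (γ t) (ν t))
    (heq : normalHorocyclePoint ε γ ν f t = normalHorocyclePoint ε γ ν l t) : f t = l t := by
  rw [normalHorocyclePoint_eq, normalHorocyclePoint_eq] at heq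
  have := congrArg (fun x => mink x ((0 : ℝ) • γ t + (1 : ℝ) • ν t + (0 : ℝ) • frameMu γ ν t)) heq
  simp only [frameMu, h.mink_comb] at this
  simpa using this

theorem IsFrame.normalHorocyclePoint_mem (h : IsFrame (γ t) (ν t)) (hγ : 0 < γ t 0)
    (hε : ε * ε = 1) (s : ℝ → ℝ) : normalHorocyclePoint ε γ ν s t ∈ hyperbolicPlane := by
  rw [normalHorocyclePoint_eq]
  refine h.comb_mem_hyperbolicPlane hγ (by positivity) ?_
  linear_combination (s t ^ 4 / 4) * hε

/-- The vector `P ∧ ν_P` of the frame of a parallel. -/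
theorem IsFrame.frameMu_parallel (h : IsFrame (γ t) (ν t)) (ε : ℝ) (l : ℝ → ℝ) :
    frameMu (parallelCurve ε γ ν l) (parallelNormal ε γ ν l) t =
      (-(ε * l t ^ 2 / 2)) • γ t + (-(ε * l t)) • ν t + (1 - l t ^ 2 / 2) • frameMu γ ν t := by
  rw [frameMu, parallelCurve, normalHorocyclePoint_eq, parallelNormal_eq, frameMu, h.wedge_comb]
  congr 2
  · congr 1; ring
  · congr 1
    ring
  · ring

theorem IsSpacelikeLegendreCurve.hasDerivWithinAt_parallelCurve
    (h : IsSpacelikeLegendreCurve I γ ν) (hI : UniqueDiffOn ℝ I) (hε : ε * ε = 1)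
    (hl : IsBernoulliSolution ε I γ ν J l) (ht : t ∈ J) :
    HasDerivWithinAt (parallelCurve ε γ ν l) ((curvM I γ ν t + l t * curvN I γ ν t) •
      frameMu (parallelCurve ε γ ν l) (parallelNormal ε γ ν l) t) J t := by
  have hd := hl.ode t ht
  have := h.hasDerivWithinAt_comb hI hl.subset ht
    (((hd.fun_pow 2).div_const 2).const_add 1) hd (((hd.fun_pow 2).const_mul ε).div_const 2)
  rw [show parallelCurve ε γ ν l = _ from funext (normalHorocyclePoint_eq ε γ ν l)]
  convert! this using 1
  rw [← show parallelCurve ε γ ν l = _ from funext (normalHorocyclePoint_eq ε γ ν l),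
    (h.isFrame (hl.subset ht)).frameMu_parallel ε, smul_add, smul_add, smul_smul, smul_smul,
    smul_smul]
  congr 2
  · congr 1; norm_num; ring
  · congr 1; norm_num; ring
  · norm_num
    linear_combination (-(l t) ^ 3 * curvN I γ ν t / 2 - l t ^ 2 * curvM I γ ν t) * (-hε)

theorem IsSpacelikeLegendreCurve.hasDerivWithinAt_parallelNormal
    (h : IsSpacelikeLegendreCurve I γ ν) (hI : UniqueDiffOn ℝ I) (hε : ε * ε = 1)
    (hl : IsBernoulliSolution ε I γ ν J l) (ht : t ∈ J) :
    HasDerivWithinAt (parallelNormal ε γ ν l) (curvN I γ ν t •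
      frameMu (parallelCurve ε γ ν l) (parallelNormal ε γ ν l) t) J t := by
  have hd := hl.ode t ht
  have := h.hasDerivWithinAt_comb hI hl.subset ht hd (hasDerivWithinAt_const t J 1)
    (hd.const_mul ε)
  rw [show parallelNormal ε γ ν l = _ from funext (parallelNormal_eq ε γ ν l)]
  convert! this using 1
  rw [← show parallelNormal ε γ ν l = _ from funext (parallelNormal_eq ε γ ν l),
    (h.isFrame (hl.subset ht)).frameMu_parallel ε, smul_add, smul_add, smul_smul, smul_smul,
    smul_smul]
  congr 2
  · congr 1; ring
  · congr 1; ring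
  · linear_combination (l t ^ 2 * curvN I γ ν t / 2 + l t * curvM I γ ν t) * hε

/-- A solution of the Bernoulli equation is as smooth as its derivative allows, hence smooth. -/
theorem IsBernoulliSolution.contDiffOn (hl : IsBernoulliSolution ε I γ ν J l)
    (h : IsSpacelikeLegendreCurve I γ ν) (hI : UniqueDiffOn ℝ I) : ContDiffOn ℝ ∞ l J := by
  have hJ := uniqueDiffOn_of_ordConnected hl.ordConnected hl.nontrivial
  refine contDiffOn_infty.2 fun n => ?_
  induction n with
  | zero => exact contDiffOn_zero.2 fun t ht => (hl.ode t ht).continuousWithinAt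
  | succ n ih =>
    have hm : ContDiffOn ℝ n (curvM I γ ν) J :=
      ((h.contDiffOn_curvM hI).mono hl.subset).of_le (by exact_mod_cast le_top)
    have hn : ContDiffOn ℝ n (curvN I γ ν) J :=
      ((h.contDiffOn_curvN hI).mono hl.subset).of_le (by exact_mod_cast le_top)
    have := (contDiffOn_succ_iff_derivWithin (n := n) hJ).2
      ⟨fun t ht => (hl.ode t ht).differentiableWithinAt, by simp,
        (contDiffOn_const.mul ((((ih.pow 2).mul hn).div_const 2).add (ih.mul hm))).congr
          fun t ht => (hl.ode t ht).derivWithin (hJ t ht)⟩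
    exact_mod_cast this

theorem IsSpacelikeLegendreCurve.parallel (h : IsSpacelikeLegendreCurve I γ ν)
    (hI : UniqueDiffOn ℝ I) (hε : ε * ε = 1) (hl : IsBernoulliSolution ε I γ ν J l) :
    IsSpacelikeLegendreCurve J (parallelCurve ε γ ν l) (parallelNormal ε γ ν l) := by
  have hJ := uniqueDiffOn_of_ordConnected hl.ordConnected hl.nontrivial
  have hls := hl.contDiffOn h hI
  refine ⟨?_, ?_, ?_, ?_, ?_, ?_⟩
  · rw [show parallelCurve ε γ ν l = _ from funext (normalHorocyclePoint_eq ε γ ν l)]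
    exact h.contDiffOn_comb hl.subset (contDiffOn_const.add ((hls.pow 2).div_const 2)) hls
      ((contDiffOn_const.mul (hls.pow 2)).div_const 2)
  · rw [show parallelNormal ε γ ν l = _ from funext (parallelNormal_eq ε γ ν l)]
    exact h.contDiffOn_comb hl.subset hls contDiffOn_const (contDiffOn_const.mul hls)
  · exact fun t ht => (h.isFrame (hl.subset ht)).normalHorocyclePoint_mem
      (h.base_mem t (hl.subset ht)).2 hε l
  · intro t ht
    rw [deSitter, mem_ofPred_eq, parallelNormal_eq, frameMu, (h.isFrame (hl.subset ht)).mink_comb]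
    linear_combination (l t ^ 2) * hε
  · intro t ht
    rw [parallelCurve, normalHorocyclePoint_eq, parallelNormal_eq, frameMu,
      (h.isFrame (hl.subset ht)).mink_comb]
    linear_combination (l t ^ 3 / 2) * hε
  · intro t ht
    rw [(h.hasDerivWithinAt_parallelCurve hI hε hl ht).derivWithin (hJ t ht), mink_smul_left,
      mink_comm, frameMu, mink_wedge_right, mul_zero]

/-- The curvature of the parallel is `(m + l n, n)`. -/
theorem curvM_parallel (h : IsSpacelikeLegendreCurve I γ ν) (hI : UniqueDiffOn ℝ I)
    (hε : ε * ε = 1) (hl : IsBernoulliSolution ε I γ ν J l) (ht : t ∈ J) :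
    curvM J (parallelCurve ε γ ν l) (parallelNormal ε γ ν l) t =
      curvM I γ ν t + l t * curvN I γ ν t := by
  have hJ := uniqueDiffOn_of_ordConnected hl.ordConnected hl.nontrivial
  rw [curvM, (h.hasDerivWithinAt_parallelCurve hI hε hl ht).derivWithin (hJ t ht), mink_smul_left,
    frameMu, ((h.parallel hI hε hl).isFrame ht).mink_wedge_wedge, mul_one]

theorem curvN_parallel (h : IsSpacelikeLegendreCurve I γ ν) (hI : UniqueDiffOn ℝ I)
    (hε : ε * ε = 1) (hl : IsBernoulliSolution ε I γ ν J l) (ht : t ∈ J) :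
    curvN J (parallelCurve ε γ ν l) (parallelNormal ε γ ν l) t = curvN I γ ν t := by
  have hJ := uniqueDiffOn_of_ordConnected hl.ordConnected hl.nontrivial
  rw [curvN, (h.hasDerivWithinAt_parallelNormal hI hε hl ht).derivWithin (hJ t ht), mink_smul_left,
    frameMu, ((h.parallel hI hε hl).isFrame ht).mink_wedge_wedge, mul_one]

/-- Local solvability of the Bernoulli equation on `I`, also at an end point: the curvature is
extended past it, and the equation is made autonomous by adding the parameter as an unknown. -/
theorem exists_isBernoulliSolution (h : IsSpacelikeLegendreCurve I γ ν) (hI : I.OrdConnected)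
    (hI' : I.Nontrivial) (ε : ℝ) {t₀ : ℝ} (ht₀ : t₀ ∈ I) (l₀ : ℝ) :
    ∃ (J : Set ℝ) (l : ℝ → ℝ), IsBernoulliSolution ε I γ ν J l ∧ t₀ ∈ J ∧ J ∈ 𝓝[I] t₀ ∧
      l t₀ = l₀ := by
  have hud := uniqueDiffOn_of_ordConnected hI hI'
  obtain ⟨m, hm, hmI⟩ := exists_contDiff_eventuallyEq_nhdsWithin hI hI' (h.contDiffOn_curvM hud) ht₀
  obtain ⟨n, hn, hnI⟩ := exists_contDiff_eventuallyEq_nhdsWithin hI hI' (h.contDiffOn_curvN hud) ht₀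
  let v : ℝ × ℝ → ℝ × ℝ := fun x => (1, -ε * (x.2 ^ 2 * n x.1 / 2 + x.2 * m x.1))
  have hv : ContDiff ℝ ∞ v := by fun_prop
  obtain ⟨α, hα0, δ, hδ, hα⟩ :=
    (hv.contDiffAt.of_le (by exact_mod_cast le_top) : ContDiffAt ℝ 1 v (t₀, l₀))
      |>.exists_forall_mem_closedBall_exists_eq_forall_mem_Ioo_hasDerivAt₀ t₀
  have hα' : ∀ᶠ t in 𝓝 t₀, HasDerivAt α (v (α t)) t := by
    filter_upwards [Ioo_mem_nhds (by linarith : t₀ - δ < t₀) (by linarith : t₀ < t₀ + δ)] using hα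
  have hα₁ : ∀ᶠ t in 𝓝 t₀, (α t).1 = t := by
    have := eventually_eq_of_hasDerivWithinAt_zero (J := univ) ordConnected_univ
      (D := fun t => (α t).1 - t) (mem_univ t₀) (by
        rw [nhdsWithin_univ]
        filter_upwards [hα'] with t ht
        have := (hasFDerivAt_fst.comp_hasDerivAt t ht).fun_sub (hasDerivAt_id' t)
        simpa [v] using this)
    rw [nhdsWithin_univ] at this
    filter_upwards [this] with t ht
    rw [hα0] at ht
    simpa [sub_eq_zero] using ht
  obtain ⟨r, hr, hball⟩ := Metric.mem_nhdsWithin_iff.1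
    (((hα'.and hα₁).filter_mono nhdsWithin_le_nhds).and (hmI.and hnI))
  have hmem : I ∩ Metric.ball t₀ r ∈ 𝓝[I] t₀ :=
    inter_mem self_mem_nhdsWithin (mem_nhdsWithin_of_mem_nhds (Metric.ball_mem_nhds t₀ hr))
  have ht₀J : t₀ ∈ I ∩ Metric.ball t₀ r := ⟨ht₀, Metric.mem_ball_self hr⟩
  refine ⟨I ∩ Metric.ball t₀ r, fun t => (α t).2, ⟨inter_subset_left, ?_, ?_, ?_⟩, ht₀J, hmem,
    by simp [hα0]⟩
  · rw [Real.ball_eq_Ioo]; exact hI.inter ordConnected_Ioo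
  · have := neBot_nhdsWithin_diff hI hI' ht₀
    have hmem' : ∀ᶠ s in 𝓝[I \ {t₀}] t₀, s ∈ I ∩ Metric.ball t₀ r :=
      nhdsWithin_mono t₀ sdiff_subset hmem
    obtain ⟨s, hs, hs'⟩ := (hmem'.and self_mem_nhdsWithin).exists
    exact ⟨s, hs, t₀, ht₀J, hs'.2⟩
  · rintro t ⟨htI, htb⟩
    obtain ⟨⟨h1, h2⟩, h3, h4⟩ := hball ⟨htb, htI⟩
    have := (hasFDerivAt_snd.comp_hasDerivAt t h1).hasDerivWithinAt (s := I ∩ Metric.ball t₀ r)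
    convert! this using 1
    simp only [v, ContinuousLinearMap.coe_snd', h2]
    rw [h3, h4]

/-! ### The horocyclic evolute as a spacelike Legendre curve -/

section Evolute

/-- A unit normal that makes the evolute a spacelike Legendre curve. -/
def evoluteNormal (ε : ℝ) (γ ν : ℝ → Fin 3 → ℝ) (f : ℝ → ℝ) (t : ℝ) : Fin 3 → ℝ :=
  (ε * f t ^ 2 / 2) • γ t + (ε * f t) • ν t + (f t ^ 2 / 2 - 1) • frameMu γ ν t

/-- The function `σ = f' - ε f² n / 2`, the first component of the curvature of the evolute. -/
def evoluteSpeed (ε : ℝ) (I : Set ℝ) (γ ν : ℝ → Fin 3 → ℝ) (f : ℝ → ℝ) (t : ℝ) : ℝ :=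
  derivWithin f I t - ε * f t ^ 2 * curvN I γ ν t / 2

theorem IsFrame.frameMu_evolute (h : IsFrame (γ t) (ν t)) (hε : ε * ε = 1) (f : ℝ → ℝ) :
    frameMu (evolute ε γ ν f) (evoluteNormal ε γ ν f) t = parallelNormal ε γ ν f t := by
  rw [frameMu, evolute, normalHorocyclePoint_eq, evoluteNormal, parallelNormal_eq, frameMu,
    h.wedge_comb]
  congr 2
  · congr 1; linear_combination (f t ^ 3 / 2) * hε
  · congr 1; linear_combination (f t ^ 4 / 4) * hε
  · ring

theorem IsFrame.parallelNormal_ne_zero (h : IsFrame (γ t) (ν t)) (f : ℝ → ℝ) :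
    parallelNormal ε γ ν f t ≠ 0 := by
  intro h0
  have := h.mink_comb (f t) 1 (ε * f t) 0 1 0
  rw [← frameMu, ← parallelNormal_eq, h0] at this
  simp [mink] at this

variable (h : IsSpacelikeLegendreCurve I γ ν) (hI : UniqueDiffOn ℝ I) (hε : ε * ε = 1)
  (hf : ContDiffOn ℝ ∞ f I) (hmfn : ∀ t ∈ I, curvM I γ ν t + f t * curvN I γ ν t = 0)

include h hI hε hf hmfn

theorem hasDerivWithinAt_evolute (ht : t ∈ I) :
    HasDerivWithinAt (evolute ε γ ν f)
      (evoluteSpeed ε I γ ν f t • frameMu (evolute ε γ ν f) (evoluteNormal ε γ ν f) t) I t := by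
  have hd := (hf.differentiableOn (by simp) t ht).hasDerivWithinAt
  have := h.hasDerivWithinAt_comb hI subset_rfl ht
    (((hd.fun_pow 2).div_const 2).const_add 1) hd (((hd.fun_pow 2).const_mul ε).div_const 2)
  rw [(h.isFrame ht).frameMu_evolute hε]
  rw [show evolute ε γ ν f = _ from funext (normalHorocyclePoint_eq ε γ ν f)]
  convert! this using 1
  have hm : curvM I γ ν t = -(f t * curvN I γ ν t) := by linarith [hmfn t ht]
  rw [parallelNormal_eq, evoluteSpeed, hm, smul_add, smul_add, smul_smul, smul_smul, smul_smul]
  congr 2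
  · congr 1; norm_num; ring
  · congr 1; ring
  · norm_num
    linear_combination (-(f t) ^ 3 * curvN I γ ν t / 2) * hε

theorem evolute_isSpacelikeLegendreCurve :
    IsSpacelikeLegendreCurve I (evolute ε γ ν f) (evoluteNormal ε γ ν f) := by
  refine ⟨?_, ?_, ?_, ?_, ?_, ?_⟩
  · rw [show evolute ε γ ν f = _ from funext (normalHorocyclePoint_eq ε γ ν f)]
    exact h.contDiffOn_comb subset_rfl (contDiffOn_const.add ((hf.pow 2).div_const 2)) hf
      ((contDiffOn_const.mul (hf.pow 2)).div_const 2)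
  · exact h.contDiffOn_comb subset_rfl ((contDiffOn_const.mul (hf.pow 2)).div_const 2)
      (contDiffOn_const.mul hf) (((hf.pow 2).div_const 2).sub contDiffOn_const)
  · exact fun t ht => (h.isFrame ht).normalHorocyclePoint_mem (h.base_mem t ht).2 hε f
  · intro t ht
    rw [deSitter, mem_ofPred_eq, evoluteNormal, frameMu, (h.isFrame ht).mink_comb]
    linear_combination (f t ^ 2 - f t ^ 4 / 4) * hε
  · intro t ht
    rw [evolute, normalHorocyclePoint_eq, evoluteNormal, frameMu, (h.isFrame ht).mink_comb]
    ring
  · intro t ht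
    rw [(hasDerivWithinAt_evolute h hI hε hf hmfn ht).derivWithin (hI t ht), mink_smul_left,
      mink_comm, frameMu, mink_wedge_right, mul_zero]

theorem curvM_evolute (ht : t ∈ I) :
    curvM I (evolute ε γ ν f) (evoluteNormal ε γ ν f) t = evoluteSpeed ε I γ ν f t := by
  rw [curvM, (hasDerivWithinAt_evolute h hI hε hf hmfn ht).derivWithin (hI t ht), mink_smul_left,
    frameMu, ((evolute_isSpacelikeLegendreCurve h hI hε hf hmfn).isFrame ht).mink_wedge_wedge,
    mul_one]

/-- The curvature of the evolute is `(σ, n + ε σ)`. -/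
theorem curvN_evolute (ht : t ∈ I) :
    curvN I (evolute ε γ ν f) (evoluteNormal ε γ ν f) t =
      curvN I γ ν t + ε * evoluteSpeed ε I γ ν f t := by
  have hd := (hf.differentiableOn (by simp) t ht).hasDerivWithinAt
  have : HasDerivWithinAt (evoluteNormal ε γ ν f) _ I t :=
    h.hasDerivWithinAt_comb hI subset_rfl ht (((hd.fun_pow 2).const_mul ε).div_const 2)
      (hd.const_mul ε) (((hd.fun_pow 2).div_const 2).sub_const 1)
  have hm : curvM I γ ν t = -(f t * curvN I γ ν t) := by linarith [hmfn t ht]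
  rw [curvN, this.derivWithin (hI t ht), (h.isFrame ht).frameMu_evolute hε, parallelNormal_eq,
    frameMu, (h.isFrame ht).mink_comb, evoluteSpeed, hm]
  norm_num
  linear_combination (3 / 2 * f t ^ 2 * curvN I γ ν t - f t ^ 4 * curvN I γ ν t / 2) * hε

end Evolute

/-! ### Cusps of parallels and of the evolute -/

section

variable {I J : Set ℝ} {γ ν : ℝ → Fin 3 → ℝ} {ε : ℝ} {f l : ℝ → ℝ} {t₀ : ℝ}

variable (h : IsSpacelikeLegendreCurve I γ ν) (hI : UniqueDiffOn ℝ I) (hε : ε * ε = 1)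
  (hf : ContDiffOn ℝ ∞ f I) (hmfn : ∀ t ∈ I, curvM I γ ν t + f t * curvN I γ ν t = 0)

include h hI hf in
theorem contDiffOn_evoluteSpeed : ContDiffOn ℝ ∞ (evoluteSpeed ε I γ ν f) I :=
  (hf.derivWithin hI (by simp)).sub
    (((contDiffOn_const.mul (hf.pow 2)).mul (h.contDiffOn_curvN hI)).div_const 2)

include hf hmfn in
/-- With `m = -f n` the Bernoulli equation becomes a Riccati equation for `g = l - f`, namely
`g' = -σ - ε n g² / 2`. -/
theorem hasDerivWithinAt_sub_radius (hl : IsBernoulliSolution ε I γ ν J l) {t : ℝ} (ht : t ∈ J) :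
    HasDerivWithinAt (fun t => l t - f t)
      (-evoluteSpeed ε I γ ν f t - ε * curvN I γ ν t * (l t - f t) ^ 2 / 2) J t := by
  have hd := (hf.differentiableOn (by simp) t (hl.subset ht)).hasDerivWithinAt.mono hl.subset
  convert! (hl.ode t ht).fun_sub hd using 1
  have hm : curvM I γ ν t = -(f t * curvN I γ ν t) := by linarith [hmfn t (hl.subset ht)]
  rw [hm, evoluteSpeed]
  ring

include h hI hε hf hmfn

/-- The first two derivatives of the curvature component `m + l n = n (l - f)` of the parallel at a
point with `l = f`. -/
theorem exists_hasDerivWithinAt_curvM_parallel (hl : IsBernoulliSolution ε I γ ν J l)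
    (ht₀ : t₀ ∈ J) (hlf : l t₀ = f t₀) :
    ∃ (h' : ℝ → ℝ) (n' : ℝ),
      (∀ t ∈ J, HasDerivWithinAt
        (curvM J (parallelCurve ε γ ν l) (parallelNormal ε γ ν l)) (h' t) J t) ∧
      h' t₀ = -(curvN I γ ν t₀ * evoluteSpeed ε I γ ν f t₀) ∧
      HasDerivWithinAt h' (n' * evoluteSpeed ε I γ ν f t₀ -
        curvN I γ ν t₀ * derivWithin (evoluteSpeed ε I γ ν f) I t₀) J t₀ := by
  have hJ := uniqueDiffOn_of_ordConnected hl.ordConnected hl.nontrivial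
  have hn := (h.contDiffOn_curvN hI).mono hl.subset
  have hnd : ∀ t ∈ J, HasDerivWithinAt (curvN I γ ν) (derivWithin (curvN I γ ν) J t) J t :=
    fun t ht => (hn.differentiableOn (by simp) t ht).hasDerivWithinAt
  have hn'd : HasDerivWithinAt (derivWithin (curvN I γ ν) J)
      (derivWithin (derivWithin (curvN I γ ν) J) J t₀) J t₀ :=
    ((hn.derivWithin hJ (m := ∞) (by simp)).differentiableOn (by simp) t₀ ht₀).hasDerivWithinAt
  have hσd : HasDerivWithinAt (evoluteSpeed ε I γ ν f)
      (derivWithin (evoluteSpeed ε I γ ν f) I t₀) J t₀ :=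
    ((contDiffOn_evoluteSpeed h hI hf).differentiableOn (by simp) t₀
      (hl.subset ht₀)).hasDerivWithinAt.mono hl.subset
  have hg := fun t (ht : t ∈ J) => hasDerivWithinAt_sub_radius (ε := ε) hf hmfn hl ht
  have heq : ∀ t ∈ J, curvM J (parallelCurve ε γ ν l) (parallelNormal ε γ ν l) t =
      curvN I γ ν t * (l t - f t) := fun t ht => by
    rw [curvM_parallel h hI hε hl ht]
    linear_combination hmfn t (hl.subset ht)
  refine ⟨_, -(2 * derivWithin (curvN I γ ν) J t₀), fun t ht =>
    ((hnd t ht).fun_mul (hg t ht)).congr heq (heq t ht), ?_, ?_⟩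
  · rw [hlf]; ring
  · have := (hn'd.fun_mul (hg t₀ ht₀)).fun_add ((hnd t₀ ht₀).fun_mul (hσd.fun_neg.fun_sub
      ((((hnd t₀ ht₀).const_mul ε).fun_mul ((hg t₀ ht₀).fun_pow 2)).div_const 2)))
    convert! this using 1
    rw [hlf]
    norm_num
    ring

theorem hasCusp_two_three_parallel_iff (hl : IsBernoulliSolution ε I γ ν J l)
    (ht₀ : t₀ ∈ J) (hlf : l t₀ = f t₀) :
    HasCusp 2 3 J (parallelCurve ε γ ν l) t₀ ↔
      evoluteSpeed ε I γ ν f t₀ ≠ 0 ∧ curvN I γ ν t₀ ≠ 0 := by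
  have hJ := uniqueDiffOn_of_ordConnected hl.ordConnected hl.nontrivial
  have hP := h.parallel hI hε hl
  obtain ⟨h', n', hd, hd0, -⟩ :=
    exists_hasDerivWithinAt_curvM_parallel h hI hε hf hmfn hl ht₀ hlf
  have h0 : curvM J (parallelCurve ε γ ν l) (parallelNormal ε γ ν l) t₀ = 0 := by
    rw [curvM_parallel h hI hε hl ht₀, hlf, hmfn t₀ (hl.subset ht₀)]
  rw [hP.hasCusp_succ_iff hl.ordConnected hl.nontrivial ht₀ one_ne_zero hasNormalForm_two_three,
    vanishesToOrder_one_iff hl.ordConnected hl.nontrivial ht₀ (hP.contDiffOn_curvM hJ) (hd t₀ ht₀),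
    curvN_parallel h hI hε hl ht₀, hd0, h0]
  simp only [ne_eq, neg_eq_zero, mul_eq_zero, not_or, true_and]
  tauto

theorem hasCusp_three_four_parallel_iff (hl : IsBernoulliSolution ε I γ ν J l)
    (ht₀ : t₀ ∈ J) (hlf : l t₀ = f t₀) :
    HasCusp 3 4 J (parallelCurve ε γ ν l) t₀ ↔
      (evoluteSpeed ε I γ ν f t₀ = 0 ∧ derivWithin (evoluteSpeed ε I γ ν f) I t₀ ≠ 0) ∧
        curvN I γ ν t₀ ≠ 0 := by
  have hJ := uniqueDiffOn_of_ordConnected hl.ordConnected hl.nontrivial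
  have hP := h.parallel hI hε hl
  obtain ⟨h', n', hd, hd0, hd'⟩ :=
    exists_hasDerivWithinAt_curvM_parallel h hI hε hf hmfn hl ht₀ hlf
  have h0 : curvM J (parallelCurve ε γ ν l) (parallelNormal ε γ ν l) t₀ = 0 := by
    rw [curvM_parallel h hI hε hl ht₀, hlf, hmfn t₀ (hl.subset ht₀)]
  rw [hP.hasCusp_succ_iff hl.ordConnected hl.nontrivial ht₀ two_ne_zero hasNormalForm_three_four,
    vanishesToOrder_two_iff hl.ordConnected hl.nontrivial ht₀ (hP.contDiffOn_curvM hJ) hd hd',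
    curvN_parallel h hI hε hl ht₀, hd0, h0]
  refine and_congr_left fun hn => ?_
  simp only [neg_eq_zero, mul_eq_zero, hn, false_or, true_and]
  refine and_congr_right fun hσ => ?_
  rw [hσ, mul_zero, zero_sub, ne_eq, neg_eq_zero, mul_eq_zero, not_or]
  simp [hn]

theorem hasCusp_two_three_evolute_iff (hIc : I.OrdConnected) (hI' : I.Nontrivial)
    (ht₀ : t₀ ∈ I) :
    HasCusp 2 3 I (evolute ε γ ν f) t₀ ↔
      (evoluteSpeed ε I γ ν f t₀ = 0 ∧ derivWithin (evoluteSpeed ε I γ ν f) I t₀ ≠ 0) ∧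
        curvN I γ ν t₀ ≠ 0 := by
  have hE := evolute_isSpacelikeLegendreCurve h hI hε hf hmfn
  have hM : ∀ t ∈ I, curvM I (evolute ε γ ν f) (evoluteNormal ε γ ν f) t =
      evoluteSpeed ε I γ ν f t := fun t ht => curvM_evolute h hI hε hf hmfn ht
  have hσd := ((contDiffOn_evoluteSpeed (ε := ε) h hI hf).differentiableOn (by simp) t₀
      ht₀).hasDerivWithinAt.congr hM (hM t₀ ht₀)
  rw [hE.hasCusp_succ_iff hIc hI' ht₀ one_ne_zero hasNormalForm_two_three,
    vanishesToOrder_one_iff hIc hI' ht₀ (hE.contDiffOn_curvM hI) hσd, hM t₀ ht₀,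
    curvN_evolute h hI hε hf hmfn ht₀]
  refine and_congr_right fun hσ => ?_
  rw [hσ.1, mul_zero, add_zero]

theorem isSingularPoint_evolute_iff (ht₀ : t₀ ∈ I) :
    IsSingularPoint I (evolute ε γ ν f) t₀ ↔ evoluteSpeed ε I γ ν f t₀ = 0 := by
  rw [IsSingularPoint, (hasDerivWithinAt_evolute h hI hε hf hmfn ht₀).derivWithin (hI t₀ ht₀),
    (h.isFrame ht₀).frameMu_evolute hε, smul_eq_zero]
  exact or_iff_left ((h.isFrame ht₀).parallelNormal_ne_zero f)

end

end Horocyclic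

end

theorem proposition3p15
    (I : Set ℝ) (hI : I.OrdConnected) (hI' : I.Nontrivial)
    (γ ν : ℝ → Fin 3 → ℝ) (hγν : Horocyclic.IsSpacelikeLegendreCurve I γ ν)
    (f : ℝ → ℝ) (hf : ContDiffOn ℝ ∞ f I)
    (hmfn : ∀ t ∈ I, Horocyclic.curvM I γ ν t + f t * Horocyclic.curvN I γ ν t = 0)
    (ε : ℝ) (hε : ε = 1 ∨ ε = -1) :
    -- (1) existence of the parallel, near every point of the interval
    ((∀ t₀ ∈ I, ∃ (J : Set ℝ) (l : ℝ → ℝ),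
        Horocyclic.IsBernoulliSolution ε I γ ν J l ∧ t₀ ∈ J ∧ J ∈ 𝓝[I] t₀ ∧ l t₀ = f t₀ ∧
        Horocyclic.evolute ε γ ν f t₀ = Horocyclic.parallelCurve ε γ ν l t₀ ∧
        Horocyclic.parallelM ε γ ν J l t₀ = 0) ∧
      -- every solution with the right value at the point gives such a parallel
      (∀ (J : Set ℝ) (l : ℝ → ℝ), Horocyclic.IsBernoulliSolution ε I γ ν J l →
        Horocyclic.IsSpacelikeLegendreCurve J (Horocyclic.parallelCurve ε γ ν l)
          (Horocyclic.parallelNormal ε γ ν l) ∧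
        ∀ t₀ ∈ J, l t₀ = f t₀ →
          Horocyclic.evolute ε γ ν f t₀ = Horocyclic.parallelCurve ε γ ν l t₀ ∧
          Horocyclic.parallelM ε γ ν J l t₀ = 0 ∧
          Horocyclic.IsSingularPoint J (Horocyclic.parallelCurve ε γ ν l) t₀) ∧
      Horocyclic.evolute ε γ ν f '' I ⊆ Horocyclic.parallelSingularValues ε I γ ν) ∧
    -- (2)
    (∀ (J : Set ℝ) (l : ℝ → ℝ), Horocyclic.IsBernoulliSolution ε I γ ν J l →
      ∀ t₀ ∈ J, Horocyclic.evolute ε γ ν f t₀ = Horocyclic.parallelCurve ε γ ν l t₀ →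
        Horocyclic.parallelM ε γ ν J l t₀ = 0 → Horocyclic.curvN I γ ν t₀ ≠ 0 →
        (¬ Horocyclic.IsSingularPoint I (Horocyclic.evolute ε γ ν f) t₀ ↔
          Horocyclic.HasCusp 2 3 J (Horocyclic.parallelCurve ε γ ν l) t₀)) ∧
    -- (3)
    (∀ (J : Set ℝ) (l : ℝ → ℝ), Horocyclic.IsBernoulliSolution ε I γ ν J l →
      ∀ t₀ ∈ J, Horocyclic.evolute ε γ ν f t₀ = Horocyclic.parallelCurve ε γ ν l t₀ →
        Horocyclic.parallelM ε γ ν J l t₀ = 0 →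
        (Horocyclic.HasCusp 2 3 I (Horocyclic.evolute ε γ ν f) t₀ ↔
          Horocyclic.HasCusp 3 4 J (Horocyclic.parallelCurve ε γ ν l) t₀)) := by
  have hud := SmoothGerm.uniqueDiffOn_of_ordConnected hI hI'
  have hεε : ε * ε = 1 := by rcases hε with rfl | rfl <;> norm_num
  have hsol : ∀ (J : Set ℝ) (l : ℝ → ℝ), Horocyclic.IsBernoulliSolution ε I γ ν J l →
      ∀ t₀ ∈ J, l t₀ = f t₀ →
        Horocyclic.evolute ε γ ν f t₀ = Horocyclic.parallelCurve ε γ ν l t₀ ∧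
        Horocyclic.parallelM ε γ ν J l t₀ = 0 ∧
        Horocyclic.IsSingularPoint J (Horocyclic.parallelCurve ε γ ν l) t₀ := by
    intro J l hl t₀ ht₀ hlf
    have hh : Horocyclic.curvM I γ ν t₀ + l t₀ * Horocyclic.curvN I γ ν t₀ = 0 := by
      rw [hlf]; exact hmfn t₀ (hl.subset ht₀)
    refine ⟨?_, ?_, ?_⟩
    · simp only [Horocyclic.evolute, Horocyclic.parallelCurve, Horocyclic.normalHorocyclePoint, hlf]
    · rw [Horocyclic.parallelM, Horocyclic.curvM_parallel hγν hud hεε hl ht₀, hh]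
    · rw [Horocyclic.IsSingularPoint,
        (hγν.hasDerivWithinAt_parallelCurve hud hεε hl ht₀).derivWithin
          (SmoothGerm.uniqueDiffOn_of_ordConnected hl.ordConnected hl.nontrivial t₀ ht₀),
        hh, zero_smul]
  have hrad : ∀ (J : Set ℝ) (l : ℝ → ℝ), Horocyclic.IsBernoulliSolution ε I γ ν J l →
      ∀ t₀ ∈ J, Horocyclic.evolute ε γ ν f t₀ = Horocyclic.parallelCurve ε γ ν l t₀ →
        l t₀ = f t₀ := fun J l hl t₀ ht₀ heq =>
    ((hγν.isFrame (hl.subset ht₀)).normalHorocyclePoint_injective heq).symm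
  refine ⟨⟨?_, ?_, ?_⟩, ?_, ?_⟩
  · intro t₀ ht₀
    obtain ⟨J, l, hl, ht₀J, hJ, hlf⟩ :=
      Horocyclic.exists_isBernoulliSolution hγν hI hI' ε ht₀ (f t₀)
    obtain ⟨h1, h2, -⟩ := hsol J l hl t₀ ht₀J hlf
    exact ⟨J, l, hl, ht₀J, hJ, hlf, h1, h2⟩
  · exact fun J l hl => ⟨hγν.parallel hud hεε hl, hsol J l hl⟩
  · rintro _ ⟨t₀, ht₀, rfl⟩
    obtain ⟨J, l, hl, ht₀J, hJ, hlf⟩ :=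
      Horocyclic.exists_isBernoulliSolution hγν hI hI' ε ht₀ (f t₀)
    obtain ⟨h1, -, h3⟩ := hsol J l hl t₀ ht₀J hlf
    exact ⟨J, l, t₀, hl, ht₀J, hJ, h3, h1.symm⟩
  · intro J l hl t₀ ht₀ heq _ hn
    rw [Horocyclic.isSingularPoint_evolute_iff hγν hud hεε hf hmfn (hl.subset ht₀),
      Horocyclic.hasCusp_two_three_parallel_iff hγν hud hεε hf hmfn hl ht₀ (hrad J l hl t₀ ht₀ heq)]
    exact (and_iff_left hn).symm
  · intro J l hl t₀ ht₀ heq _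
    rw [Horocyclic.hasCusp_two_three_evolute_iff hγν hud hεε hf hmfn hI hI' (hl.subset ht₀),
      Horocyclic.hasCusp_three_four_parallel_iff hγν hud hεε hf hmfn hl ht₀
        (hrad J l hl t₀ ht₀ heq)]
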